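/- Let $E=(0,\infty)$ and let $\mathcal M_+$ be the set of positive Radon measures on $E$; for $\nu\in\mathcal M_+$ put $m_2(\nu)=\int_E x^2\,\nu(dx)\in[0,\infty]$. Let $\mathcal E_2$ be the space of $C^2$ functions $f:E\to\mathbb R$ such that $f,f',f''$ have finite limits at $0$ and at $\infty$, $f(0^+)=f'(0^+)=0$, and $|f'(x)|+|f''(x)|\le Ce^{-\alpha x}$ on $E$ for some constants $C$ and $\alpha>0$. For $K(x,y)=xy$ write $$\langle f,L(\nu)\rangle=\frac12\int_E\int_E\,[f(x+y)-f(x)-f(y)]\,xy\,\nu(dx)\,\nu(dy).$$ A map $t\mapsto\nu_t$ from $[0,T)$ to $\mathcal M_+$ is a (weak) solution of Smoluchowski's coagulation equation with kernel $xy$ on $[0,T)$ if (1) $m_2(\nu_0)<\infty$; (2) $t\mapsto\nu_t(B)$ is measurable on $[0,T)$ for every compact $B\subset E$; (3) $\int_0^t m_2(\nu_\tau)^2\,d\tau<\infty$ for all $t\in(0,T)$; and (4) for all $f\in\mathcal E_2$ and $t\in[0,T)$ the integrals below converge and $$\int_E f\,d\nu_t=\int_E f\,d\nu_0+\int_0^t\langle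 f,L(\nu_\tau)\rangle\,d\tau .$$ Theorem. Let $\nu_0\in\mathcal M_+$ satisfy $m_2(\nu_0)<\infty$, and let $T=1/m_2(\nu_0)$ (with $T=\infty$ if $\nu_0=0$). Then there is exactly one solution $(\nu_t)_{t\in[0,T)}$ of Smoluchowski's coagulation equation with kernel $K(x,y)=xy$ on $[0,T)$ with initial data $\nu_0$. Moreover, for all $t\in[0,T)$ and $s>0$ the integral $\psi(t,s)=\int_E(1-e^{-sx})\,x\,\nu_t(dx)$ converges, and $\psi$ is differentiable in $s$ and in $t$ (from the right at $t=0$) and solves the inviscid Burgers equation $\partial_t\psi-\psi\,\partial_s\psi=0$. -/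

import Mathlib

open MeasureTheory Filter Topology Set
open scoped ENNReal

noncomputable section

namespace Smoluchowski

/-- The space `E = (0, ∞)` of cluster sizes, with its Borel `σ`-algebra. -/
abbrev E : Type := Set.Ioi (0 : ℝ)

/-- Positive Radon measures on `E`: Borel measures that are finite on compact subsets of `E`
(on this locally compact, second countable space such measures are automatically regular). -/
def IsRadon (ν : Measure E) : Prop := ∀ B : Set E, IsCompact B → ν B < ∞

/-- The `p`-th moment `m_p = ∫_E x^p ν(dx)`, an element of `[0, ∞]`. -/
def moment (p : ℕ) (ν : Measure E) : ℝ≥0∞ := ∫⁻ x : E, ENNReal.ofReal ((x : ℝ) ^ p) ∂ν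

/-- The space `𝓔_k` of test functions. Only the values of `f` on `(0, ∞)` matter. The function is
`C^k` on `(0, ∞)`; it and its derivatives up to order `k` extend continuously to `[0, ∞]`; the
derivatives of orders `1, …, k` decay exponentially; those of orders `0, …, k - 1` vanish
at `0`. -/
structure IsTestFunction (k : ℕ) (f : ℝ → ℝ) : Prop where
  contDiffOn : ContDiffOn ℝ k f (Ioi 0)
  limit_zero : ∀ j ≤ k, ∃ a : ℝ, Tendsto (iteratedDeriv j f) (𝓝[>] 0) (𝓝 a)
  limit_top : ∀ j ≤ k, ∃ a : ℝ, Tendsto (iteratedDeriv j f) atTop (𝓝 a)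
  decay : ∃ C α : ℝ, 0 < α ∧ ∀ x > 0,
    ∑ j ∈ Finset.Icc 1 k, |iteratedDeriv j f x| ≤ C * Real.exp (-α * x)
  vanish_zero : ∀ j < k, Tendsto (iteratedDeriv j f) (𝓝[>] 0) (𝓝 0)

/-- The coagulation operator in weak form,
`⟨f, L(ν)⟩ = 1/2 ∫_E ∫_E [f(x+y) - f(x) - f(y)] K(x,y) ν(dx) ν(dy)`. -/
def coag (K : ℝ → ℝ → ℝ) (f : ℝ → ℝ) (ν : Measure E) : ℝ :=
  (1 / 2) * ∫ x : E, ∫ y : E, (f (x + y) - f x - f y) * K x y ∂ν ∂ν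

/-- The time interval `[0, T)`, where `T ∈ [0, ∞]`. -/
def timeInterval (T : ℝ≥0∞) : Set ℝ := {t | 0 ≤ t ∧ ENNReal.ofReal t < T}

/-- `t ↦ ν t` is a (weak, measure-valued) solution on `[0, T)` to Smoluchowski's coagulation
equation whose kernel `K` is homogeneous of degree `γ`. Values of `ν` outside `[0, T)` are
irrelevant. By `moment_sq` the moment `m_γ(τ)` is finite for almost every `τ`, and it is at those
times that the double integral defining `⟨f, L(ν_τ)⟩` converges. -/
structure IsSolution (K : ℝ → ℝ → ℝ) (γ : ℕ) (T : ℝ≥0∞) (ν : ℝ → Measure E) : Prop where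
  radon : ∀ t ∈ timeInterval T, IsRadon (ν t)
  moment_zero : moment γ (ν 0) < ∞
  measurable : ∀ B : Set E, IsCompact B → Measurable fun t : timeInterval T => ν t B
  moment_sq : ∀ t ∈ timeInterval T, ∫⁻ τ in Ioc 0 t, moment γ (ν τ) ^ 2 < ∞
  integrable : ∀ f : ℝ → ℝ, IsTestFunction γ f → ∀ t ∈ timeInterval T,
    Integrable (fun x : E => f x) (ν t)
  intervalIntegrable : ∀ f : ℝ → ℝ, IsTestFunction γ f → ∀ t ∈ timeInterval T,
    IntervalIntegrable (fun τ => coag K f (ν τ)) volume 0 t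
  weak_eq : ∀ f : ℝ → ℝ, IsTestFunction γ f → ∀ t ∈ timeInterval T,
    ∫ x : E, f x ∂(ν t) = ∫ x : E, f x ∂(ν 0) + ∫ τ in (0 : ℝ)..t, coag K f (ν τ)

/-- `ψ(s) = ∫_E (1 - e^{-s x}) x ν(dx)`. -/
def psi (ν : Measure E) (s : ℝ) : ℝ := ∫ x : E, (1 - Real.exp (-s * x)) * x ∂ν

end Smoluchowski

end

/-! Testing the equation formally with `x (1 - e^{-s x})` turns the coagulation term into `ψ ∂ₛψ`,
so `ψ` solves `∂ₜψ = ψ ∂ₛψ`. The characteristics of this equation are straight lines along which `ψ`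
is constant, so `c = ψ(t,s)` must satisfy `c = ψ₀(s + t c)`. As `ψ₀` is Lipschitz with constant
`m₂(ν₀)`, this equation has exactly one nonnegative root while `t m₂(ν₀) < 1`; that is `burgers`.

Existence. The root must be the transform of a measure (`exists_measure_psi_eq_burgers`). Put `η(s)
= s + t c(s)` and let `Λ = ψ₀'`, a Laplace transform. Then `η' = G ∘ η` with `G = 1/(1 - tΛ)`
completely monotone, and induction on the order of differentiation makes `η'`, hence also `∂ₛc`,
completely monotone (`IsCM.comp_of_ode`, `isCM_deriv_burgers`). Bernstein's theorem
`exists_measure_laplace_eq`, derived from the Hausdorff moment problem on `[0, 1]`, writes `∂ₛc` as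
the Laplace transform of a measure `ρ`, and `ν_t = x⁻² ρ`. The weak equation holds for sums of `x (1
- e^{-k x})` because it is then Burgers' equation integrated in time. It passes to every test
function `f` because `(f/x)'` is a uniform limit of exponential sums (Weierstrass in `u = e^{-x}`),
and a uniform bound on `(f/x)'` controls both sides of the equation through `m₂` and `m₂²` (`Tame`).

Uniqueness. The function `x (1 - e^{-s x})` is not a test function, but it is the increasing limit
of the test functions `x e^{-εx} - x e^{-s x}` as `ε ↓ 0`. The integrability of `m₂²` kills the
extra term, so the transform of any solution satisfies Burgers' equation integrated in time
(`IsSolution.psi_eq_add_integral`). A Gronwall argument along the characteristic gives the implicit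
equation (`IsSolution.psi_eq_psi_zero`), whose root is unique. Finally `ψ` determines the measure
(`measure_ext_of_psi`): the differences `ψ(m+1) - ψ(m)` are the moments of a finite measure on `[0,
1]`. -/

namespace Smoluchowski

/-! ### The Hausdorff moment problem on `[0, 1]` -/

open Polynomial in
-- Multiply by `(X + (1 - X))^d = 1` and expand. The coefficients obtained are close to `(k/n)^m`,
-- the values of the monomial at the nodes.
theorem X_pow_eq_sum_bernstein (m d : ℕ) :
    (X : ℝ[X]) ^ m = ∑ k ∈ Finset.range (m + d + 1),
      ((k.choose m : ℝ) / ((m + d).choose m : ℝ)) • bernsteinPolynomial ℝ (m + d) k := by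
  have h1 : (X : ℝ[X]) ^ m = X ^ m * (X + (1 - X)) ^ d := by simp
  rw [h1, add_pow, show m + d + 1 = m + (d + 1) by ring, Finset.sum_range_add (fun k => ((k.choose m : ℝ) / ((m + d).choose m : ℝ)) •
      bernsteinPolynomial ℝ (m + d) k) m (d + 1),
    Finset.sum_eq_zero (s := Finset.range m), zero_add, Finset.mul_sum]
  · refine Finset.sum_congr rfl fun j hj => ?_
    have hj' : j ≤ d := by simpa [Nat.lt_succ_iff] using hj
    have h2 := Nat.choose_mul (n := m + d) (k := m + j) (s := m) (by omega)
    have h3 : ((m + d).choose m : ℝ) ≠ 0 := by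
      exact_mod_cast (Nat.choose_pos (by omega)).ne'
    have h4 : ((d.choose j : ℕ) : ℝ) =
        ((m + j).choose m : ℝ) / ((m + d).choose m : ℝ) * ((m + d).choose (m + j) : ℝ) := by
      have h5 : (m + d).choose (m + j) * (m + j).choose m = (m + d).choose m * d.choose j := by
        simpa using h2
      field_simp
      exact_mod_cast (by rw [mul_comm, ← h5, mul_comm])
    rw [bernsteinPolynomial, show m + d - (m + j) = d - j by omega, pow_add, smul_eq_C_mul,
      ← Polynomial.C_eq_natCast, ← Polynomial.C_eq_natCast]
    rw [show (C ((d.choose j : ℕ) : ℝ) : ℝ[X]) = _ from congrArg C h4, C_mul]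
    ring
  · intro k hk
    rw [Nat.choose_eq_zero_of_lt (by simpa using hk)]
    simp

/-- The quotient is the product of the factors `(k - i)/(n - i)`, `i < m`, each within `M/(n - M)`
of `k/n`. All factors lie in `[0, 1]`, so the errors add. Truncated subtraction gives the correct
value `0` once `i ≥ k`. -/
theorem abs_choose_div_choose_sub_pow_le {k n M : ℕ} (hk : k ≤ n) (hM : M < n) {m : ℕ} (hm : m ≤ M) :
    |(k.choose m : ℝ) / (n.choose m : ℝ) - ((k : ℝ) / n) ^ m| ≤ m * ((M : ℝ) / ((n : ℝ) - M)) := by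
  induction m with
  | zero => simp
  | succ m ih =>
    have ih := ih (by omega)
    have hn0 : (0 : ℝ) < n := by exact_mod_cast (by omega : 0 < n)
    have hnm : (0 : ℝ) < ((n - m : ℕ) : ℝ) := by exact_mod_cast (by omega : 0 < n - m)
    have hcn : (0 : ℝ) < (n.choose m : ℝ) := by exact_mod_cast Nat.choose_pos (by omega)
    have hb0 : (0 : ℝ) ≤ (k : ℝ) / n := by positivity
    have hb1 : (k : ℝ) / n ≤ 1 := by
      rw [div_le_one hn0]; exact_mod_cast hk
    set a : ℝ := ((k - m : ℕ) : ℝ) / ((n - m : ℕ) : ℝ) with ha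
    have ha0 : 0 ≤ a := by positivity
    have ha1 : a ≤ 1 := by
      rw [ha, div_le_one hnm]; exact_mod_cast (by omega : k - m ≤ n - m)
    have hr : (k.choose (m + 1) : ℝ) / (n.choose (m + 1) : ℝ)
        = (k.choose m : ℝ) / (n.choose m : ℝ) * a := by
      have e1 : (k.choose (m + 1) : ℝ) * (m + 1) = k.choose m * ((k - m : ℕ) : ℝ) := by
        exact_mod_cast Nat.choose_succ_right_eq k m
      have e2 : (n.choose (m + 1) : ℝ) * (m + 1) = n.choose m * ((n - m : ℕ) : ℝ) := by
        exact_mod_cast Nat.choose_succ_right_eq n m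
      have hm1 : (0 : ℝ) < (m : ℝ) + 1 := by positivity
      have e3 : (k.choose (m + 1) : ℝ) = k.choose m * ((k - m : ℕ) : ℝ) / (m + 1) := by
        field_simp; linarith
      have e4 : (n.choose (m + 1) : ℝ) = n.choose m * ((n - m : ℕ) : ℝ) / (m + 1) := by
        field_simp; linarith
      rw [e3, e4, ha]
      field_simp
    have hab : |a - (k : ℝ) / n| ≤ (M : ℝ) / ((n : ℝ) - M) := by
      have hmM : (m : ℝ) ≤ M := by exact_mod_cast (by omega : m ≤ M)
      have hMn : (M : ℝ) < n := by exact_mod_cast hM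
      have hcast : ((n - m : ℕ) : ℝ) = n - m := by rw [Nat.cast_sub (by omega)]
      have hm0 : (0 : ℝ) ≤ m := by positivity
      rcases le_or_gt m k with hmk | hmk
      · have hck : ((k - m : ℕ) : ℝ) = k - m := by rw [Nat.cast_sub hmk]
        have hkn : (k : ℝ) ≤ n := by exact_mod_cast hk
        have : a - (k : ℝ) / n = - ((m : ℝ) * ((n - k) / n) / (n - m)) := by
          rw [ha, hcast, hck]
          rw [hcast] at hnm
          field_simp
          ring
        rw [hcast] at hnm
        rw [this, abs_neg, abs_of_nonneg (by
          apply div_nonneg _ hnm.le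
          exact mul_nonneg hm0 (div_nonneg (by linarith) hn0.le))]
        have h6 : ((n : ℝ) - k) / n ≤ 1 := by rw [div_le_one hn0]; linarith [(k.cast_nonneg : (0:ℝ) ≤ k)]
        apply div_le_div₀ (by linarith) _ (by linarith) (by linarith)
        nlinarith
      · have : a = 0 := by rw [ha, Nat.sub_eq_zero_of_le hmk.le]; simp
        rw [this, zero_sub, abs_neg, abs_of_nonneg hb0]
        apply div_le_div₀ (by linarith) _ (by linarith) (by linarith)
        have : (k : ℝ) ≤ m := by exact_mod_cast hmk.le
        linarith
    rw [hr, pow_succ]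
    have e : (k.choose m : ℝ) / (n.choose m : ℝ) * a - ((k : ℝ) / n) ^ m * ((k : ℝ) / n)
        = ((k.choose m : ℝ) / (n.choose m : ℝ) - ((k : ℝ) / n) ^ m) * a
          + ((k : ℝ) / n) ^ m * (a - (k : ℝ) / n) := by ring
    rw [e]
    refine (abs_add_le _ _).trans ?_
    rw [abs_mul, abs_mul, abs_of_nonneg ha0, abs_of_nonneg (pow_nonneg hb0 m)]
    have h7 : ((k : ℝ) / n) ^ m ≤ 1 := pow_le_one₀ hb0 hb1
    push_cast
    have h8 := mul_le_mul ih ha1 ha0 ((abs_nonneg _).trans ih)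
    have h9 := mul_le_mul h7 hab (abs_nonneg _) zero_le_one
    linarith

open Polynomial in
/-- Hausdorff's moment theorem on `[0, 1]`. -/
theorem exists_measure_integral_eval_eq (Λ : ℝ[X] →ₗ[ℝ] ℝ)
    (hΛ : ∀ k j : ℕ, 0 ≤ Λ (X ^ k * (1 - X) ^ j)) :
    ∃ P : Measure unitInterval, IsFiniteMeasure P ∧
      ∀ m : ℕ, ∫ u : unitInterval, (u : ℝ) ^ m ∂P = Λ (X ^ m) := by
  have hb : ∀ n k, 0 ≤ Λ (bernsteinPolynomial ℝ n k) := by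
    intro n k
    have : bernsteinPolynomial ℝ n k = (n.choose k : ℝ) • (X ^ k * (1 - X) ^ (n - k)) := by
      rw [bernsteinPolynomial, smul_eq_C_mul, ← Polynomial.C_eq_natCast, mul_assoc]
    rw [this, map_smul, smul_eq_mul]
    exact mul_nonneg (by positivity) (hΛ _ _)
  have hsum : ∀ n, ∑ k ∈ Finset.range (n + 1), Λ (bernsteinPolynomial ℝ n k) = Λ 1 := by
    intro n
    rw [← map_sum, bernsteinPolynomial.sum]
  let z : ℕ → ℕ → unitInterval := fun n k => Set.projIcc 0 1 zero_le_one ((k : ℝ) / n)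
  have hz : ∀ n k, k ≤ n → ((z n k : unitInterval) : ℝ) = (k : ℝ) / n := by
    intro n k hk
    have h0 : (0 : ℝ) ≤ (k : ℝ) / n := by positivity
    have h1 : (k : ℝ) / n ≤ 1 := div_le_one_of_le₀ (by exact_mod_cast hk) (by positivity)
    simp [z, Set.projIcc, h0, h1]
  -- Discrete approximants: atoms at `k/n` whose weights are the values of `Λ` on the Bernstein
  -- polynomials. Their total mass is `Λ 1` for every `n`.
  let Q : ℕ → FiniteMeasure unitInterval := fun n =>
    ⟨∑ k ∈ Finset.range (n + 1), ENNReal.ofReal (Λ (bernsteinPolynomial ℝ n k)) •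
      Measure.dirac (z n k), ⟨by
        simp only [Measure.coe_finsetSum, Finset.sum_apply, Measure.smul_apply, smul_eq_mul]
        exact ENNReal.sum_lt_top.2 fun k _ => by simp⟩⟩
  have hQint : ∀ n (f : unitInterval → ℝ), ∫ u, f u ∂(Q n : Measure unitInterval)
      = ∑ k ∈ Finset.range (n + 1), Λ (bernsteinPolynomial ℝ n k) * f (z n k) := by
    intro n f
    change ∫ u, f u ∂(∑ k ∈ Finset.range (n + 1), ENNReal.ofReal (Λ (bernsteinPolynomial ℝ n k)) •
      Measure.dirac (z n k)) = _
    rw [integral_finsetSum_measure]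
    · refine Finset.sum_congr rfl fun k _ => ?_
      rw [integral_smul_measure, integral_dirac, ENNReal.toReal_ofReal (hb n k), smul_eq_mul]
    · intro k _
      exact (integrable_dirac (by simp)).smul_measure ENNReal.ofReal_ne_top
  have hmass : ∀ n, (Q n).mass ≤ (Λ 1).toNNReal := by
    intro n
    have h1 := hQint n (fun _ => 1)
    simp only [mul_one, hsum] at h1
    have h2 : ∫ u : unitInterval, (1 : ℝ) ∂(Q n : Measure unitInterval) = ((Q n).mass : ℝ) := by
      rw [integral_const, smul_eq_mul, mul_one]
      rfl
    rw [h2] at h1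
    rw [← h1, Real.toNNReal_coe]
  -- Measures of bounded mass on a compact space are weakly compact; a limit along an ultrafilter
  -- replaces the extraction of a subsequence.
  have hcomp := isCompact_setOfPred_finiteMeasure_le_of_compactSpace (E := unitInterval) (Λ 1).toNNReal
  let F : Ultrafilter ℕ := hyperfilter ℕ
  obtain ⟨P, -, hP⟩ := hcomp.ultrafilter_le_nhds (F.map Q) (by
    rw [le_principal_iff]
    exact Filter.mem_map.2 (Filter.univ_mem' hmass))
  have hF : (F : Filter ℕ) ≤ atTop := Nat.hyperfilter_le_atTop
  have hlim : Tendsto Q F (𝓝 P) := hP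
  refine ⟨P, inferInstance, fun m => ?_⟩
  let f : BoundedContinuousFunction unitInterval ℝ :=
    BoundedContinuousFunction.mkOfCompact ⟨fun u => (u : ℝ) ^ m, by fun_prop⟩
  have h1 := (FiniteMeasure.tendsto_iff_forall_integral_tendsto.1 hlim) f
  refine tendsto_nhds_unique h1 (Tendsto.mono_left ?_ hF)
  rw [tendsto_iff_dist_tendsto_zero]
  have hlim0 : Tendsto (fun n : ℕ => Λ 1 * (m * ((m : ℝ) / ((n : ℝ) - m)))) atTop (𝓝 0) := by
    have : Tendsto (fun n : ℕ => (m : ℝ) / ((n : ℝ) - m)) atTop (𝓝 0) :=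
      Tendsto.const_div_atTop (tendsto_atTop_add_const_right _ _ tendsto_natCast_atTop_atTop) _
    simpa using (this.const_mul (m : ℝ)).const_mul (Λ 1)
  refine squeeze_zero' (Eventually.of_forall fun _ => dist_nonneg) ?_ hlim0
  filter_upwards [eventually_gt_atTop m] with n hn
  obtain ⟨d, rfl⟩ := Nat.exists_eq_add_of_le hn.le
  rw [Real.dist_eq, hQint, X_pow_eq_sum_bernstein m d, map_sum, ← Finset.sum_sub_distrib]
  refine (Finset.abs_sum_le_sum_abs _ _).trans ?_
  rw [← hsum (m + d), Finset.sum_mul]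
  refine Finset.sum_le_sum fun k hk => ?_
  have hk' : k ≤ m + d := by simpa [Nat.lt_succ_iff] using hk
  rw [map_smul, smul_eq_mul, mul_comm (_ / _ : ℝ), ← mul_sub, abs_mul, abs_of_nonneg (hb _ _)]
  refine mul_le_mul_of_nonneg_left ?_ (hb _ _)
  change |((z (m + d) k : unitInterval) : ℝ) ^ m - _| ≤ _
  rw [hz _ _ hk', abs_sub_comm]
  exact abs_choose_div_choose_sub_pow_le hk' hn le_rfl

/-! ### Finite measures on `[0, 1]` and their moments -/

theorem integral_polynomial_eq_sum (P : Measure unitInterval) [IsFiniteMeasure P]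
    (p : Polynomial ℝ) : ∫ u : unitInterval, p.eval (u : ℝ) ∂P
      = ∑ i ∈ Finset.range (p.natDegree + 1), p.coeff i * ∫ u : unitInterval, (u : ℝ) ^ i ∂P := by
  simp_rw [Polynomial.eval_eq_sum_range]
  rw [integral_finsetSum]
  · simp_rw [integral_const_mul]
  · intro i _
    exact Continuous.integrable_of_hasCompactSupport (by fun_prop)
      (HasCompactSupport.of_compactSpace _)

/-- One sequence serves all finite measures at once. Integrals of continuous functions are thus
limits of fixed expressions in the moments, which yields both determinacy and measurability in a
parameter. -/
theorem exists_polynomial_seq_tendsto_integral (f : C(unitInterval, ℝ)) :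
    ∃ p : ℕ → Polynomial ℝ, ∀ (P : Measure unitInterval) [IsFiniteMeasure P],
      Tendsto (fun n => ∫ u : unitInterval, (p n).eval (u : ℝ) ∂P) atTop (𝓝 (∫ u, f u ∂P)) := by
  have h : ∀ n : ℕ, ∃ p : Polynomial ℝ, ‖p.toContinuousMapOn (Set.Icc 0 1) - f‖ < 1 / (n + 1 : ℝ) :=
    fun n => exists_polynomial_near_continuousMap 0 1 f _ (by positivity)
  choose p hp using h
  refine ⟨p, fun P _ => ?_⟩
  have hlim : Tendsto (fun n : ℕ => P.real univ * (1 / (n + 1 : ℝ))) atTop (𝓝 0) := by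
    simpa using (tendsto_one_div_add_atTop_nhds_zero_nat (𝕜 := ℝ)).const_mul (P.real univ)
  rw [tendsto_iff_norm_sub_tendsto_zero]
  refine squeeze_zero (fun _ => norm_nonneg _) (fun n => ?_) hlim
  rw [← integral_sub]
  · refine (norm_integral_le_of_norm_le_const (C := 1 / (n + 1 : ℝ))
      (Eventually.of_forall fun u => ?_)).trans_eq (mul_comm _ _)
    exact ((p n).toContinuousMapOn (Set.Icc 0 1) - f).norm_coe_le_norm u |>.trans (hp n).le
  · exact Continuous.integrable_of_hasCompactSupport (by fun_prop)
      (HasCompactSupport.of_compactSpace _)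
  · exact Continuous.integrable_of_hasCompactSupport (by fun_prop)
      (HasCompactSupport.of_compactSpace _)

/-- Finite measures on `[0, 1]` are determined by their moments. -/
theorem unitInterval_measure_ext {P Q : Measure unitInterval} [IsFiniteMeasure P]
    [IsFiniteMeasure Q]
    (h : ∀ m : ℕ, ∫ u : unitInterval, (u : ℝ) ^ m ∂P = ∫ u : unitInterval, (u : ℝ) ^ m ∂Q) :
    P = Q := by
  refine ext_of_forall_integral_eq_of_IsFiniteMeasure fun f => ?_
  obtain ⟨p, hp⟩ := exists_polynomial_seq_tendsto_integral f.toContinuousMap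
  refine tendsto_nhds_unique (hp P) ?_
  simp_rw [integral_polynomial_eq_sum, h, ← integral_polynomial_eq_sum]
  exact hp Q

/-- A family of finite measures on `[0, 1]` whose moments are measurable is measurable. -/
theorem measurable_of_measurable_moments {T : Type*} [MeasurableSpace T]
    (P : T → Measure unitInterval) [∀ t, IsFiniteMeasure (P t)]
    (h : ∀ m : ℕ, Measurable fun t => ∫ u : unitInterval, (u : ℝ) ^ m ∂(P t)) :
    Measurable P := by
  have hc : ∀ f : C(unitInterval, ℝ), Measurable fun t => ∫ u, f u ∂(P t) := by
    intro f
    obtain ⟨p, hp⟩ := exists_polynomial_seq_tendsto_integral f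
    refine measurable_of_tendsto_metrizable (f := fun n t => ∫ u : unitInterval, (p n).eval (u : ℝ) ∂(P t))
      (fun n => ?_) (tendsto_pi_nhds.2 fun t => hp (P t))
    simp_rw [integral_polynomial_eq_sum]
    exact Finset.measurable_sum _ fun i _ => (h i).const_mul _
  have hclosed : ∀ F : Set unitInterval, IsClosed F → Measurable fun t => P t F := by
    intro F hF
    have hr : Measurable fun t => (P t).real F := by
      have hδ : ∀ n : ℕ, (0 : ℝ) < 1 / (n + 1) := fun n => by positivity
      refine measurable_of_tendsto_metrizable
        (f := fun n t => ∫ u, (thickenedIndicator (hδ n) F u : ℝ) ∂(P t)) (fun n => ?_)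
        (tendsto_pi_nhds.2 fun t => tendsto_integral_thickenedIndicator_of_isClosed (P t) hF hδ
          tendsto_one_div_add_atTop_nhds_zero_nat)
      exact hc ⟨fun u => (thickenedIndicator (hδ n) F u : ℝ), by fun_prop⟩
    have : (fun t => P t F) = fun t => ENNReal.ofReal ((P t).real F) := by
      ext t; simp [Measure.real]
    rw [this]
    exact hr.ennreal_ofReal
  refine Measurable.measure_of_isPiSystem (S := {F | IsClosed F})
    ((BorelSpace.measurable_eq (α := unitInterval)).trans borel_eq_generateFrom_isClosed)
    isPiSystem_isClosed (fun F hF => hclosed F hF) (hclosed _ isClosed_univ)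

/-! ### Completely monotone functions -/

/-- Complete monotonicity on `(0, ∞)` up to order `n`: the first `n` derivatives of `f` exist and
alternate in sign. -/
def IsCM : ℕ → (ℝ → ℝ) → Prop
  | 0, f => ∀ s > 0, 0 ≤ f s
  | n + 1, f => (∀ s > 0, 0 ≤ f s) ∧
      ∃ f' : ℝ → ℝ, (∀ s > 0, HasDerivAt f (-(f' s)) s) ∧ IsCM n f'

namespace IsCM

theorem nonneg {n : ℕ} {f : ℝ → ℝ} (h : IsCM n f) : ∀ s > 0, 0 ≤ f s := by
  cases n with
  | zero => exact h
  | succ n => exact h.1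

theorem of_succ {n : ℕ} {f : ℝ → ℝ} (h : IsCM (n + 1) f) : IsCM n f := by
  induction n generalizing f with
  | zero => exact h.1
  | succ n ih =>
    obtain ⟨h0, f', hf', h'⟩ := h
    exact ⟨h0, f', hf', ih h'⟩

theorem add {n : ℕ} {f g : ℝ → ℝ} (hf : IsCM n f) (hg : IsCM n g) :
    IsCM n (fun s => f s + g s) := by
  induction n generalizing f g with
  | zero => exact fun s hs => add_nonneg (hf s hs) (hg s hs)
  | succ n ih =>
    obtain ⟨h0, f', hf', h'⟩ := hf
    obtain ⟨k0, g', hg', k'⟩ := hg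
    refine ⟨fun s hs => add_nonneg (h0 s hs) (k0 s hs), _, fun s hs => ?_, ih h' k'⟩
    exact ((hf' s hs).add (hg' s hs)).congr_deriv (by ring)

theorem mul {n : ℕ} {f g : ℝ → ℝ} (hf : IsCM n f) (hg : IsCM n g) :
    IsCM n (fun s => f s * g s) := by
  induction n generalizing f g with
  | zero => exact fun s hs => mul_nonneg (hf s hs) (hg s hs)
  | succ n ih =>
    have hf0 := hf.of_succ
    have hg0 := hg.of_succ
    obtain ⟨h0, f', hf', h'⟩ := hf
    obtain ⟨k0, g', hg', k'⟩ := hg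
    refine ⟨fun s hs => mul_nonneg (h0 s hs) (k0 s hs), _, fun s hs => ?_,
      (ih h' hg0).add (ih hf0 k')⟩
    exact ((hf' s hs).mul (hg' s hs)).congr_deriv (by ring)

theorem const_mul {n : ℕ} {f : ℝ → ℝ} (hf : IsCM n f) {a : ℝ} (ha : 0 ≤ a) :
    IsCM n (fun s => a * f s) := by
  induction n generalizing f with
  | zero => exact fun s hs => mul_nonneg ha (hf s hs)
  | succ n ih =>
    obtain ⟨h0, f', hf', h'⟩ := hf
    refine ⟨fun s hs => mul_nonneg ha (h0 s hs), _, fun s hs => ?_, ih h'⟩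
    exact ((hf' s hs).const_mul a).congr_deriv (by ring)

/-- The composition of a completely monotone function with a function whose derivative is
completely monotone is completely monotone. -/
theorem comp {n : ℕ} {f η e : ℝ → ℝ} (hf : IsCM (n + 1) f) (he : IsCM n e)
    (hη : ∀ s > 0, 0 < η s) (hd : ∀ s > 0, HasDerivAt η (e s) s) :
    IsCM (n + 1) (fun s => f (η s)) := by
  induction n generalizing f with
  | zero =>
    obtain ⟨h0, f', hf', h'⟩ := hf
    refine ⟨fun s hs => h0 _ (hη s hs), fun s => f' (η s) * e s, fun s hs => ?_,
      fun s hs => mul_nonneg (h' _ (hη s hs)) (he s hs)⟩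
    exact ((hf' _ (hη s hs)).comp s (hd s hs)).congr_deriv (by ring)
  | succ n ih =>
    obtain ⟨h0, f', hf', h'⟩ := hf
    refine ⟨fun s hs => h0 _ (hη s hs), fun s => f' (η s) * e s, fun s hs => ?_,
      (ih h' he.of_succ).mul he⟩
    exact ((hf' _ (hη s hs)).comp s (hd s hs)).congr_deriv (by ring)

/-- If `η' = G ∘ η` with `G` completely monotone, then `η'` is completely monotone. -/
theorem comp_of_ode {G η : ℝ → ℝ} (hG : ∀ n, IsCM n G) (hη : ∀ s > 0, 0 < η s)
    (hd : ∀ s > 0, HasDerivAt η (G (η s)) s) (n : ℕ) : IsCM n (fun s => G (η s)) := by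
  induction n with
  | zero => exact fun s hs => hG 0 _ (hη s hs)
  -- Bootstrap: `η'` of order `n` is exactly the input that gives `G ∘ η`, which is `η'` again,
  -- order `n + 1`.
  | succ n ih => exact (hG (n + 1)).comp ih hη hd

theorem antitoneOn {n : ℕ} {f : ℝ → ℝ} (h : IsCM (n + 1) f) : AntitoneOn f (Ioi 0) := by
  obtain ⟨-, f', hf', h'⟩ := h
  refine antitoneOn_of_deriv_nonpos (convex_Ioi 0)
    (fun s hs => (hf' s hs).continuousAt.continuousWithinAt)
    (fun s hs => (hf' s (by simpa using hs)).differentiableAt.differentiableWithinAt)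
    fun s hs => ?_
  have hs : 0 < s := by simpa using hs
  rw [(hf' s hs).deriv]
  linarith [h'.nonneg s hs]

/-- Differencing commutes with differentiation, so only the sign needs an argument. The sign comes
from monotonicity, which costs one order. -/
theorem sub_shift {n : ℕ} {f : ℝ → ℝ} (hf : IsCM (n + 1) f) {h : ℝ} (hh : 0 ≤ h) :
    IsCM n (fun s => f s - f (s + h)) := by
  have h0 : ∀ s > 0, 0 ≤ f s - f (s + h) := fun s hs =>
    sub_nonneg.2 (hf.antitoneOn (mem_Ioi.2 hs) (mem_Ioi.2 (by linarith)) (by linarith))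
  induction n generalizing f with
  | zero => exact h0
  | succ n ih =>
    obtain ⟨k0, f', hf', h'⟩ := hf
    refine ⟨h0, _, fun s hs => ?_, ih h' ?_⟩
    · exact ((hf' s hs).sub ((hf' (s + h) (by linarith)).comp_add_const s h)).congr_deriv (by ring)
    · exact fun s hs =>
        sub_nonneg.2 (h'.antitoneOn (mem_Ioi.2 hs) (mem_Ioi.2 (by linarith)) (by linarith))

end IsCM

/-! ### Bernstein's theorem by sampling -/

/-- The linear functional on polynomials with moments `g (k h)`. -/
noncomputable def sampleFunctional (g : ℝ → ℝ) (h : ℝ) : Polynomial ℝ →ₗ[ℝ] ℝ :=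
  Polynomial.lsum fun i => LinearMap.mulRight ℝ (g (i * h))

theorem sampleFunctional_X_pow (g : ℝ → ℝ) (h : ℝ) (k : ℕ) :
    sampleFunctional g h (Polynomial.X ^ k) = g (k * h) := by
  rw [sampleFunctional, Polynomial.lsum_apply, ← Polynomial.monomial_one_right_eq_X_pow,
    Polynomial.sum_monomial_index _ _ (by simp)]
  simp

/-- Multiplying by `X` shifts the sample point by `h`, so multiplying by `1 - X` is a finite
difference. Hausdorff's positivity condition thereby becomes the sign of the iterated differences of
`g`. -/
theorem sampleFunctional_X_pow_mul (g : ℝ → ℝ) (h : ℝ) (k j : ℕ) :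
    sampleFunctional g h (Polynomial.X ^ k * (1 - Polynomial.X) ^ j)
      = (fun (f : ℝ → ℝ) s => f s - f (s + h))^[j] g (k * h) := by
  induction j generalizing k with
  | zero => simp [sampleFunctional_X_pow]
  | succ j ih =>
    have : (Polynomial.X : Polynomial ℝ) ^ k * (1 - Polynomial.X) ^ (j + 1)
        = Polynomial.X ^ k * (1 - Polynomial.X) ^ j
          - Polynomial.X ^ (k + 1) * (1 - Polynomial.X) ^ j := by ring
    rw [this, map_sub, ih, ih, Function.iterate_succ_apply',
      show ((k + 1 : ℕ) : ℝ) * h = k * h + h by push_cast; ring]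

theorem iterate_sub_shift_nonneg {g : ℝ → ℝ} (hg : ∀ n, IsCM n g) (hc : ContinuousOn g (Ici 0))
    {h : ℝ} (hh : 0 ≤ h) (j : ℕ) {s : ℝ} (hs : 0 ≤ s) :
    0 ≤ (fun (f : ℝ → ℝ) s => f s - f (s + h))^[j] g s := by
  have key : ∀ j, (∀ n, IsCM n ((fun (f : ℝ → ℝ) s => f s - f (s + h))^[j] g)) ∧
      ContinuousOn ((fun (f : ℝ → ℝ) s => f s - f (s + h))^[j] g) (Ici 0) := by
    intro j
    induction j with
    | zero => exact ⟨hg, hc⟩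
    | succ j ih =>
      rw [Function.iterate_succ_apply']
      refine ⟨fun n => (ih.1 (n + 1)).sub_shift hh, ih.2.sub (ih.2.comp (by fun_prop) ?_)⟩
      exact fun s hs => mem_Ici.2 (add_nonneg hs hh)
  obtain ⟨h1, h2⟩ := key j
  rcases hs.eq_or_lt with rfl | hs
  · have h3 : Tendsto ((fun (f : ℝ → ℝ) s => f s - f (s + h))^[j] g) (𝓝[>] 0)
        (𝓝 ((fun (f : ℝ → ℝ) s => f s - f (s + h))^[j] g 0)) :=
      (h2 0 (mem_Ici.2 le_rfl)).mono_left (nhdsWithin_mono _ Ioi_subset_Ici_self)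
    exact ge_of_tendsto h3 (eventually_nhdsWithin_of_forall fun s hs => h1 0 s hs)
  · exact h1 0 s hs

theorem exists_measure_moment_eq_sample {g : ℝ → ℝ} (hg : ∀ n, IsCM n g)
    (hc : ContinuousOn g (Ici 0)) {h : ℝ} (hh : 0 ≤ h) :
    ∃ P : Measure unitInterval, IsFiniteMeasure P ∧
      ∀ m : ℕ, ∫ u : unitInterval, (u : ℝ) ^ m ∂P = g (m * h) := by
  obtain ⟨P, hP, hPm⟩ := exists_measure_integral_eval_eq (sampleFunctional g h) fun k j => by
    rw [sampleFunctional_X_pow_mul]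
    exact iterate_sub_shift_nonneg hg hc hh j (by positivity)
  exact ⟨P, hP, fun m => by rw [hPm, sampleFunctional_X_pow]⟩

theorem integrable_of_continuous_unitInterval (P : Measure unitInterval) [IsFiniteMeasure P]
    {f : unitInterval → ℝ} (hf : Continuous f) : Integrable f P :=
  hf.integrable_of_hasCompactSupport (HasCompactSupport.of_compactSpace _)

/-- The measure `P` is built from the samples at the integers. The one built from mesh `1/N`, pushed
forward by `u ↦ u^N`, has the same integer moments and hence equals `P`; this gives the formula at
`k/N`. Real exponents follow by continuity. -/
theorem exists_measure_rpow_integral_eq {g : ℝ → ℝ} (hg : ∀ n, IsCM n g)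
    (hc : ContinuousOn g (Ici 0)) :
    ∃ P : Measure unitInterval, IsFiniteMeasure P ∧ P.real univ = g 0 ∧
      ∀ s > 0, ∫ u : unitInterval, (u : ℝ) ^ s ∂P = g s := by
  obtain ⟨P, hP, hPm⟩ := exists_measure_moment_eq_sample hg hc zero_le_one
  refine ⟨P, hP, by simpa using hPm 0, fun s hs => ?_⟩
  have hrat : ∀ N k : ℕ, 0 < N → ∫ u : unitInterval, (u : ℝ) ^ ((k : ℝ) / N) ∂P = g (k / N) := by
    intro N k hN
    obtain ⟨Q, hQ, hQm⟩ := exists_measure_moment_eq_sample hg hc (h := 1 / N) (by positivity)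
    have hN0 : (N : ℝ) ≠ 0 := by positivity
    have hmeas : Measurable fun u : unitInterval => u ^ N := by fun_prop
    have hPQ : P = Q.map (fun u : unitInterval => u ^ N) := by
      have := Measure.isFiniteMeasure_map Q (fun u : unitInterval => u ^ N)
      refine unitInterval_measure_ext fun m => ?_
      rw [integral_map hmeas.aemeasurable (by fun_prop), hPm]
      simp only [Set.Icc.coe_pow, ← pow_mul]
      rw [hQm]
      congr 1
      push_cast
      field_simp
    rw [hPQ, integral_map hmeas.aemeasurable
      (by exact (measurable_subtype_coe.pow_const _).aestronglyMeasurable)]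
    have : ∀ u : unitInterval, (((u ^ N : unitInterval) : ℝ)) ^ ((k : ℝ) / N) = (u : ℝ) ^ k := by
      intro u
      rw [Set.Icc.coe_pow, ← Real.rpow_natCast, ← Real.rpow_mul u.2.1,
        mul_div_cancel₀ _ hN0, Real.rpow_natCast]
    simp_rw [this]
    rw [hQm]
    congr 1
    ring
  have hseq : Tendsto (fun n : ℕ => (⌈s * n⌉₊ : ℝ) / n) atTop (𝓝 s) :=
    (tendsto_nat_ceil_mul_div_atTop hs.le).comp tendsto_natCast_atTop_atTop
  have h1 : Tendsto (fun n : ℕ => g ((⌈s * n⌉₊ : ℝ) / n)) atTop (𝓝 (g s)) :=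
    ((hc.continuousAt (Ici_mem_nhds hs)).tendsto).comp hseq
  have h2 : Tendsto (fun n : ℕ => ∫ u : unitInterval, (u : ℝ) ^ ((⌈s * n⌉₊ : ℝ) / n) ∂P) atTop
      (𝓝 (∫ u : unitInterval, (u : ℝ) ^ s ∂P)) := by
    refine tendsto_integral_of_dominated_convergence (fun _ => 1)
      (fun n => (measurable_subtype_coe.pow_const _).aestronglyMeasurable) (integrable_const _)
      (fun n => Eventually.of_forall fun u => ?_) (Eventually.of_forall fun u => ?_)
    · rw [Real.norm_of_nonneg (Real.rpow_nonneg u.2.1 _)]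
      exact Real.rpow_le_one u.2.1 u.2.2 (by positivity)
    · exact ((Real.continuousAt_const_rpow' hs.ne').tendsto).comp hseq
  refine tendsto_nhds_unique h2 (h1.congr' ?_)
  filter_upwards [eventually_gt_atTop 0] with n hn
  rw [hrat n _ hn]

/-! ### Transfer from `[0, 1]` to `(0, ∞)` by `u = e^{-x}` -/

instance : PolishSpace E := isOpen_Ioi.polishSpace

/-- The embedding `x ↦ e^{-x}` of `(0, ∞)` into `[0, 1]`. -/
noncomputable def expNeg (x : E) : unitInterval :=
  ⟨Real.exp (-x), (Real.exp_pos _).le, Real.exp_le_one_iff.2 (neg_nonpos.2 x.2.le)⟩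

theorem continuous_expNeg : Continuous expNeg := by
  unfold expNeg
  fun_prop

theorem measurableEmbedding_expNeg : MeasurableEmbedding expNeg := by
  refine continuous_expNeg.measurableEmbedding fun x y h => ?_
  have h1 : Real.exp (-x) = Real.exp (-y) := congrArg Subtype.val h
  exact Subtype.ext (neg_injective (Real.exp_injective h1))

theorem mem_range_expNeg {u : unitInterval} (h0 : u ≠ 0) (h1 : u ≠ 1) : u ∈ range expNeg := by
  have hu0 : 0 < (u : ℝ) := unitInterval.pos_iff_ne_zero.2 h0
  have hu1 : (u : ℝ) < 1 := unitInterval.lt_one_iff_ne_one.2 h1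
  refine ⟨⟨-Real.log u, by simpa using Real.log_neg hu0 hu1⟩, Subtype.ext ?_⟩
  simp [expNeg, Real.exp_log hu0]

/-- Bernstein's theorem for bounded completely monotone functions vanishing at infinity. -/
theorem exists_measure_laplace_eq {g : ℝ → ℝ} (hg : ∀ n, IsCM n g)
    (hc : ContinuousOn g (Ici 0)) (hinf : Tendsto g atTop (𝓝 0)) :
    ∃ ρ : Measure E, ρ univ ≤ ENNReal.ofReal (g 0) ∧
      ∀ s > 0, ∫ x : E, Real.exp (-s * x) ∂ρ = g s := by
  obtain ⟨P, hP, hP0, hPs⟩ := exists_measure_rpow_integral_eq hg hc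
  -- The endpoint `u = 1` stands for `x = 0`, and decay of `g` at infinity excludes an atom there.
  -- An atom at `u = 0`, that is `x = ∞`, contributes nothing since `0^s = 0`; dropping it leaves an
  -- inequality for the total mass.
  have h1 : P {1} = 0 := by
    have hle : ∀ k : ℕ, 0 < k → P.real {1} ≤ g k := by
      intro k hk
      have e : P.real {1} = ∫ u : unitInterval, ({1} : Set unitInterval).indicator 1 u ∂P := by
        rw [integral_indicator_one (measurableSet_singleton _)]
      rw [← hPs k (by positivity), e]
      refine integral_mono ((integrable_const 1).indicator (measurableSet_singleton _))
        (integrable_of_continuous_unitInterval P (by simp_rw [Real.rpow_natCast]; fun_prop))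
        fun u => ?_
      by_cases hu : u = 1
      · simp [hu]
      · simp only [Set.indicator_of_notMem (show u ∉ ({1} : Set unitInterval) from hu)]
        exact Real.rpow_nonneg u.2.1 _
    have h2 : P.real {1} ≤ 0 :=
      ge_of_tendsto (hinf.comp tendsto_natCast_atTop_atTop)
        ((eventually_gt_atTop 0).mono hle)
    have h3 : P.real {1} = 0 := le_antisymm h2 measureReal_nonneg
    simpa [Measure.real, ENNReal.toReal_eq_zero_iff] using h3
  refine ⟨P.comap expNeg, ?_, fun s hs => ?_⟩
  · rw [measurableEmbedding_expNeg.comap_apply, ← hP0, ofReal_measureReal]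
    exact measure_mono (subset_univ _)
  · have h2 := measurableEmbedding_expNeg.integral_map (μ := P.comap expNeg)
      (fun u : unitInterval => (u : ℝ) ^ s)
    rw [measurableEmbedding_expNeg.map_comap] at h2
    have h3 : ∀ x : E, ((expNeg x : unitInterval) : ℝ) ^ s = Real.exp (-s * x) := by
      intro x
      simp only [expNeg]
      rw [← Real.exp_mul]
      congr 1
      ring
    simp_rw [h3] at h2
    rw [← h2, ← hPs s hs]
    refine setIntegral_eq_integral_of_ae_compl_eq_zero ?_
    have h4 : ∀ᵐ u ∂P, u ≠ 1 := by
      rw [ae_iff]; simpa using h1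
    filter_upwards [h4] with u hu1 hu
    have : u = 0 := by
      by_contra h0
      exact hu (mem_range_expNeg h0 hu1)
    simp [this, hs.ne']

/-! ### The transform `ψ` and the weighted Laplace transforms of a measure -/

theorem mul_exp_neg_le_one_sub (z : ℝ) : z * Real.exp (-z) ≤ 1 - Real.exp (-z) := by
  have h1 := Real.add_one_le_exp z
  have h2 : Real.exp z * Real.exp (-z) = 1 := by rw [← Real.exp_add]; simp
  nlinarith [Real.exp_pos (-z)]

theorem mul_exp_neg_le_one (z : ℝ) : z * Real.exp (-z) ≤ 1 := by
  linarith [mul_exp_neg_le_one_sub z, Real.exp_pos (-z)]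

theorem one_sub_exp_nonneg {s x : ℝ} (hs : 0 ≤ s) (hx : 0 ≤ x) : 0 ≤ 1 - Real.exp (-s * x) := by
  have : Real.exp (-s * x) ≤ 1 := Real.exp_le_one_iff.2 (by nlinarith)
  linarith

theorem one_sub_exp_mul_nonneg {s x : ℝ} (hs : 0 ≤ s) (hx : 0 ≤ x) :
    0 ≤ (1 - Real.exp (-s * x)) * x :=
  mul_nonneg (one_sub_exp_nonneg hs hx) hx

theorem one_sub_exp_mul_le {s x : ℝ} (hx : 0 ≤ x) : (1 - Real.exp (-s * x)) * x ≤ s * x ^ 2 := by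
  nlinarith [Real.add_one_le_exp (-s * x)]

theorem exp_mul_sq_le {s x : ℝ} (hs : 0 < s) (hx : 0 ≤ x) :
    Real.exp (-s * x) * x ^ 2 ≤ (1 - Real.exp (-s * x)) * x / s := by
  rw [le_div_iff₀ hs]
  have := mul_exp_neg_le_one_sub (s * x)
  rw [← neg_mul] at this
  nlinarith

/-- Half of the exponential pays for one extra power of `x`, through `z e^{-z} ≤ 1`. -/
theorem exp_two_mul_pow_succ_le {s x : ℝ} (hs : 0 < s) (hx : 0 ≤ x) (k : ℕ) :
    Real.exp (-(2 * s) * x) * x ^ (k + 1) ≤ Real.exp (-s * x) * x ^ k / s := by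
  rw [le_div_iff₀ hs]
  have h1 := mul_exp_neg_le_one (s * x)
  rw [← neg_mul] at h1
  have h2 : Real.exp (-(2 * s) * x) = Real.exp (-s * x) * Real.exp (-s * x) := by
    rw [← Real.exp_add]; ring_nf
  have h3 : 0 ≤ Real.exp (-s * x) * x ^ k := mul_nonneg (Real.exp_pos _).le (pow_nonneg hx k)
  calc Real.exp (-(2 * s) * x) * x ^ (k + 1) * s
      = (Real.exp (-s * x) * x ^ k) * (s * x * Real.exp (-s * x)) := by rw [h2]; ring
    _ ≤ (Real.exp (-s * x) * x ^ k) * 1 := mul_le_mul_of_nonneg_left h1 h3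
    _ = _ := mul_one _

/-- The Laplace transform `∫ e^{-s x} x^k ν(dx)`. -/
noncomputable def lap (k : ℕ) (ν : Measure E) (s : ℝ) : ℝ :=
  ∫ x : E, Real.exp (-s * x) * (x : ℝ) ^ k ∂ν

/-- All the integrals defining `ψ(s)`, `s > 0`, converge. -/
def PsiIntegrable (ν : Measure E) : Prop :=
  ∀ s > 0, Integrable (fun x : E => (1 - Real.exp (-s * x)) * (x : ℝ)) ν

theorem integrable_sq_of_moment_lt_top {ν : Measure E} (h : moment 2 ν < ∞) :
    Integrable (fun x : E => (x : ℝ) ^ 2) ν := by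
  refine ⟨by fun_prop, ?_⟩
  rw [hasFiniteIntegral_iff_ofReal (Eventually.of_forall fun x => sq_nonneg _)]
  exact h

theorem integral_sq_eq_toReal_moment (ν : Measure E) :
    ∫ x : E, (x : ℝ) ^ 2 ∂ν = (moment 2 ν).toReal :=
  integral_eq_lintegral_of_nonneg_ae (Eventually.of_forall fun x => sq_nonneg _) (by fun_prop)

theorem psiIntegrable_of_moment_lt_top {ν : Measure E} (h : moment 2 ν < ∞) :
    PsiIntegrable ν := by
  intro s hs
  refine ((integrable_sq_of_moment_lt_top h).const_mul s).mono' (by fun_prop)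
    (Eventually.of_forall fun x => ?_)
  rw [Real.norm_of_nonneg (one_sub_exp_mul_nonneg hs.le x.2.le)]
  exact one_sub_exp_mul_le x.2.le

/-- The integrand of `ψ` dominates `s e^{-s x} x²`, and each further power is bought with half of
the exponent. Finiteness of `m₂` is not required, which matters for uniqueness: a solution is
assumed to have finite `m₂` only at almost every time. -/
theorem PsiIntegrable.exp_mul_pow {ν : Measure E} (h : PsiIntegrable ν) {s : ℝ} (hs : 0 < s)
    {k : ℕ} (hk : 2 ≤ k) : Integrable (fun x : E => Real.exp (-s * x) * (x : ℝ) ^ k) ν := by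
  induction k, hk using Nat.le_induction generalizing s with
  | base =>
    refine ((h s hs).div_const s).mono' (by fun_prop) (Eventually.of_forall fun x => ?_)
    rw [Real.norm_of_nonneg (by positivity)]
    exact exp_mul_sq_le hs x.2.le
  | succ k hk ih =>
    refine ((ih (half_pos hs)).div_const (s / 2)).mono' (by fun_prop)
      (Eventually.of_forall fun x => ?_)
    have hx : (0 : ℝ) < x := x.2
    rw [Real.norm_of_nonneg (by positivity)]
    have := exp_two_mul_pow_succ_le (half_pos hs) hx.le k
    rwa [show 2 * (s / 2) = s by ring] at this

theorem psi_nonneg (ν : Measure E) {s : ℝ} (hs : 0 ≤ s) : 0 ≤ psi ν s :=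
  integral_nonneg fun x => one_sub_exp_mul_nonneg hs x.2.le

theorem lap_nonneg (k : ℕ) (ν : Measure E) (s : ℝ) : 0 ≤ lap k ν s :=
  integral_nonneg fun x => mul_nonneg (Real.exp_pos _).le (pow_nonneg x.2.le k)

theorem psi_zero (ν : Measure E) : psi ν 0 = 0 := by simp [psi]

theorem PsiIntegrable.psi_mono {ν : Measure E} (h : PsiIntegrable ν) {s s' : ℝ} (hs : 0 < s)
    (hss : s ≤ s') : psi ν s ≤ psi ν s' := by
  refine integral_mono (h s hs) (h s' (hs.trans_le hss)) fun x => ?_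
  have hx : (0 : ℝ) < x := x.2
  refine mul_le_mul_of_nonneg_right ?_ hx.le
  have : Real.exp (-s' * x) ≤ Real.exp (-s * x) := Real.exp_le_exp.2 (by nlinarith)
  linarith

theorem PsiIntegrable.lap_anti {ν : Measure E} (h : PsiIntegrable ν) {s s' : ℝ} (hs : 0 < s)
    (hss : s ≤ s') {k : ℕ} (hk : 2 ≤ k) : lap k ν s' ≤ lap k ν s := by
  refine integral_mono (h.exp_mul_pow (hs.trans_le hss) hk) (h.exp_mul_pow hs hk) fun x => ?_
  have hx : (0 : ℝ) < x := x.2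
  exact mul_le_mul_of_nonneg_right (Real.exp_le_exp.2 (by nlinarith)) (by positivity)

theorem PsiIntegrable.lap_two_le {ν : Measure E} (h : PsiIntegrable ν) {s : ℝ} (hs : 0 < s) :
    lap 2 ν s ≤ psi ν s / s := by
  rw [psi, ← integral_div]
  exact integral_mono (h.exp_mul_pow hs le_rfl) ((h s hs).div_const s)
    fun x => exp_mul_sq_le hs x.2.le

theorem PsiIntegrable.lap_succ_le {ν : Measure E} (h : PsiIntegrable ν) {s : ℝ} (hs : 0 < s)
    {k : ℕ} (hk : 2 ≤ k) : lap (k + 1) ν (2 * s) ≤ lap k ν s / s := by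
  rw [lap, lap, ← integral_div]
  exact integral_mono (h.exp_mul_pow (by positivity) (by omega)) ((h.exp_mul_pow hs hk).div_const s)
    fun x => exp_two_mul_pow_succ_le hs x.2.le k

theorem psi_le_mul_moment {ν : Measure E} (h : moment 2 ν < ∞) {s : ℝ} (hs : 0 < s) :
    psi ν s ≤ s * (moment 2 ν).toReal := by
  rw [← integral_sq_eq_toReal_moment, ← integral_const_mul]
  exact integral_mono (psiIntegrable_of_moment_lt_top h s hs)
    ((integrable_sq_of_moment_lt_top h).const_mul s) fun x => one_sub_exp_mul_le x.2.le

theorem lap_two_le_moment {ν : Measure E} (h : moment 2 ν < ∞) {s : ℝ} (hs : 0 ≤ s) :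
    lap 2 ν s ≤ (moment 2 ν).toReal := by
  rw [← integral_sq_eq_toReal_moment]
  refine integral_mono_of_nonneg (Eventually.of_forall fun x => by positivity)
    (integrable_sq_of_moment_lt_top h) (Eventually.of_forall fun x => ?_)
  have hx : (0 : ℝ) < x := x.2
  have : Real.exp (-s * x) ≤ 1 := Real.exp_le_one_iff.2 (by nlinarith)
  exact mul_le_of_le_one_left (by positivity) this

theorem hasDerivAt_exp_neg_mul (x s : ℝ) :
    HasDerivAt (fun s => Real.exp (-s * x)) (-(Real.exp (-s * x) * x)) s := by
  have h : HasDerivAt (fun s : ℝ => -s * x) (-1 * x) s := (hasDerivAt_neg s).mul_const x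
  exact h.exp.congr_deriv (by ring)

theorem PsiIntegrable.hasDerivAt_psi {ν : Measure E} (h : PsiIntegrable ν) {s : ℝ} (hs : 0 < s) :
    HasDerivAt (psi ν) (lap 2 ν s) s := by
  refine (hasDerivAt_integral_of_dominated_loc_of_deriv_le (s := Ioi (s / 2))
    (F' := fun s (x : E) => Real.exp (-s * x) * (x : ℝ) ^ 2)
    (bound := fun x : E => Real.exp (-(s / 2) * x) * (x : ℝ) ^ 2)
    (Ioi_mem_nhds (half_lt_self hs)) (Eventually.of_forall fun _ => by fun_prop)
    (h s hs) (by fun_prop) (Eventually.of_forall fun x σ hσ => ?_)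
    (h.exp_mul_pow (half_pos hs) le_rfl) (Eventually.of_forall fun x σ hσ => ?_)).2
  · have hx : (0 : ℝ) < x := x.2
    have hσ : s / 2 < σ := hσ
    rw [Real.norm_of_nonneg (by positivity)]
    exact mul_le_mul_of_nonneg_right (Real.exp_le_exp.2 (by nlinarith)) (by positivity)
  · exact (((hasDerivAt_exp_neg_mul x σ).const_sub 1).mul_const (x : ℝ)).congr_deriv (by ring)

theorem PsiIntegrable.hasDerivAt_lap {ν : Measure E} (h : PsiIntegrable ν) {s : ℝ} (hs : 0 < s)
    {k : ℕ} (hk : 2 ≤ k) : HasDerivAt (lap k ν) (-(lap (k + 1) ν s)) s := by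
  rw [lap, ← integral_neg]
  refine (hasDerivAt_integral_of_dominated_loc_of_deriv_le (s := Ioi (s / 2))
    (F' := fun s (x : E) => -(Real.exp (-s * x) * (x : ℝ) ^ (k + 1)))
    (bound := fun x : E => Real.exp (-(s / 2) * x) * (x : ℝ) ^ (k + 1))
    (Ioi_mem_nhds (half_lt_self hs)) (Eventually.of_forall fun _ => by fun_prop)
    (h.exp_mul_pow hs hk) (by fun_prop) (Eventually.of_forall fun x σ hσ => ?_)
    (h.exp_mul_pow (half_pos hs) (by omega)) (Eventually.of_forall fun x σ hσ => ?_)).2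
  · have hx : (0 : ℝ) < x := x.2
    have hσ : s / 2 < σ := hσ
    rw [norm_neg, Real.norm_of_nonneg (by positivity)]
    exact mul_le_mul_of_nonneg_right (Real.exp_le_exp.2 (by nlinarith)) (by positivity)
  · exact ((hasDerivAt_exp_neg_mul x σ).mul_const ((x : ℝ) ^ k)).congr_deriv (by ring)

theorem PsiIntegrable.isCM_lap {ν : Measure E} (h : PsiIntegrable ν) (n : ℕ) {k : ℕ}
    (hk : 2 ≤ k) : IsCM n (lap k ν) := by
  induction n generalizing k with
  | zero => exact fun s _ => lap_nonneg k ν s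
  | succ n ih =>
    exact ⟨fun s _ => lap_nonneg k ν s, _, fun s hs => h.hasDerivAt_lap hs hk, ih (by omega)⟩

theorem continuousOn_lap_two {ν : Measure E} (h : moment 2 ν < ∞) :
    ContinuousOn (lap 2 ν) (Ici 0) := by
  refine continuousOn_of_dominated (bound := fun x : E => (x : ℝ) ^ 2) (fun s hs => by fun_prop)
    (fun s hs => Eventually.of_forall fun x => ?_) (integrable_sq_of_moment_lt_top h)
    (Eventually.of_forall fun x => by fun_prop)
  have hx : (0 : ℝ) < x := x.2
  have hs : 0 ≤ s := hs
  rw [Real.norm_of_nonneg (by positivity)]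
  exact mul_le_of_le_one_left (by positivity) (Real.exp_le_one_iff.2 (by nlinarith))

theorem tendsto_lap_two_atTop {ν : Measure E} (h : moment 2 ν < ∞) :
    Tendsto (lap 2 ν) atTop (𝓝 0) := by
  have h1 : Tendsto (fun s => ∫ x : E, Real.exp (-s * x) * (x : ℝ) ^ 2 ∂ν) atTop
      (𝓝 (∫ x : E, (0 : ℝ) ∂ν)) := by
    refine tendsto_integral_filter_of_dominated_convergence (fun x : E => (x : ℝ) ^ 2)
      (Eventually.of_forall fun s => by fun_prop) ?_ (integrable_sq_of_moment_lt_top h)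
      (Eventually.of_forall fun x => ?_)
    · filter_upwards [eventually_ge_atTop 0] with s hs
      refine Eventually.of_forall fun x => ?_
      have hx : (0 : ℝ) < x := x.2
      rw [Real.norm_of_nonneg (by positivity)]
      exact mul_le_of_le_one_left (by positivity) (Real.exp_le_one_iff.2 (by nlinarith))
    · have hx : (0 : ℝ) < x := x.2
      have h2 : Tendsto (fun s : ℝ => -s * x) atTop atBot :=
        tendsto_neg_atTop_atBot.atBot_mul_const hx
      simpa using (Real.tendsto_exp_atBot.comp h2).mul_const ((x : ℝ) ^ 2)
  rwa [integral_zero] at h1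

theorem tendsto_psi_zero {ν : Measure E} (h : moment 2 ν < ∞) :
    Tendsto (psi ν) (𝓝[>] 0) (𝓝 0) := by
  have h1 : Tendsto (fun s : ℝ => s * (moment 2 ν).toReal) (𝓝[>] 0) (𝓝 0) := by
    have : Tendsto (fun s : ℝ => s * (moment 2 ν).toReal) (𝓝 0) (𝓝 (0 * (moment 2 ν).toReal)) :=
      tendsto_id.mul_const _
    rw [zero_mul] at this
    exact this.mono_left nhdsWithin_le_nhds
  exact squeeze_zero' (eventually_nhdsWithin_of_forall fun s hs => psi_nonneg ν (mem_Ioi.1 hs).le)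
    (eventually_nhdsWithin_of_forall fun s hs => psi_le_mul_moment h hs) h1

/-! ### Recovering a measure from its transform -/

/-- The density of the finite measure attached to `ν` which is used to identify `ν` from `ψ`. -/
noncomputable def weight (x : E) : ℝ≥0∞ := ENNReal.ofReal ((1 - Real.exp (-1 * x)) * x)

theorem measurable_weight : Measurable weight := by
  unfold weight
  fun_prop

theorem weight_pos (x : E) : weight x ≠ 0 := by
  have hx : (0 : ℝ) < x := x.2
  have h1 : Real.exp (-1 * x) < 1 := Real.exp_lt_one_iff.2 (by linarith)
  simp only [weight, ne_eq, ENNReal.ofReal_eq_zero, not_le]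
  exact mul_pos (by linarith) hx

theorem weight_ne_top (x : E) : weight x ≠ ∞ := ENNReal.ofReal_ne_top

/-- The image on `[0, 1]` of the measure `(1 - e^{-x}) x ν(dx)`. -/
noncomputable def weightedImage (ν : Measure E) : Measure unitInterval :=
  (ν.withDensity weight).map expNeg

theorem withDensity_comap_weightedImage (ν : Measure E) :
    ((weightedImage ν).comap expNeg).withDensity (fun x => (weight x)⁻¹) = ν := by
  rw [weightedImage, measurableEmbedding_expNeg.comap_map]
  exact withDensity_inv_same measurable_weight (Eventually.of_forall weight_pos)
    (Eventually.of_forall weight_ne_top)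

theorem PsiIntegrable.isFiniteMeasure_weightedImage {ν : Measure E} (h : PsiIntegrable ν) :
    IsFiniteMeasure (weightedImage ν) := by
  have : IsFiniteMeasure (ν.withDensity weight) :=
    isFiniteMeasure_withDensity_ofReal (h 1 one_pos).2
  exact Measure.isFiniteMeasure_map (ν.withDensity weight) expNeg

/-- The integrand `(1 - e^{-x}) x e^{-m x}` telescopes into the integrands of `ψ` at `m + 1` and at
`m`. Hence the values of `ψ` at integers already determine the measure. -/
theorem PsiIntegrable.integral_pow_weightedImage {ν : Measure E} (h : PsiIntegrable ν) (m : ℕ) :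
    ∫ u : unitInterval, (u : ℝ) ^ m ∂(weightedImage ν) = psi ν (m + 1) - psi ν m := by
  rw [weightedImage, measurableEmbedding_expNeg.integral_map,
    integral_withDensity_eq_integral_toReal_smul measurable_weight
      (Eventually.of_forall fun x => (weight_ne_top x).lt_top)]
  have hm : Integrable (fun x : E => (1 - Real.exp (-(m : ℝ) * x)) * (x : ℝ)) ν := by
    rcases Nat.eq_zero_or_pos m with rfl | hm
    · simp
    · exact h m (by positivity)
  rw [psi, psi, ← integral_sub (h _ (by positivity)) hm]
  refine integral_congr_ae (Eventually.of_forall fun x => ?_)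
  have hx : (0 : ℝ) < x := x.2
  simp only [weight, expNeg, smul_eq_mul]
  rw [ENNReal.toReal_ofReal (one_sub_exp_mul_nonneg zero_le_one hx.le), ← Real.exp_nat_mul,
    show -((m : ℝ) + 1) * x = -1 * x + m * -x by ring, Real.exp_add,
    show -(m : ℝ) * x = m * -x by ring]
  ring

theorem measure_ext_of_psi {ν ν' : Measure E} (h : PsiIntegrable ν) (h' : PsiIntegrable ν')
    (hpsi : ∀ s > 0, psi ν s = psi ν' s) : ν = ν' := by
  have := h.isFiniteMeasure_weightedImage
  have := h'.isFiniteMeasure_weightedImage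
  have hw : weightedImage ν = weightedImage ν' := by
    refine unitInterval_measure_ext fun m => ?_
    rw [h.integral_pow_weightedImage, h'.integral_pow_weightedImage, hpsi _ (by positivity)]
    rcases Nat.eq_zero_or_pos m with rfl | hm
    · simp [psi_zero]
    · rw [hpsi _ (by positivity)]
  rw [← withDensity_comap_weightedImage ν, hw, withDensity_comap_weightedImage]

/-- Serves the measurability clause of a solution: the moments of the weighted image depend
measurably on the parameter, and dividing out a fixed positive density preserves this. -/
theorem measurable_of_measurable_psi {T : Type*} [MeasurableSpace T] {ν : T → Measure E}
    (h : ∀ t, PsiIntegrable (ν t)) (hpsi : ∀ s > 0, Measurable fun t => psi (ν t) s) :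
    Measurable ν := by
  have := fun t => (h t).isFiniteMeasure_weightedImage
  have hw : Measurable fun t => weightedImage (ν t) := by
    refine measurable_of_measurable_moments _ fun m => ?_
    simp_rw [fun t => (h t).integral_pow_weightedImage]
    refine (hpsi _ (by positivity)).sub ?_
    rcases Nat.eq_zero_or_pos m with rfl | hm
    · simp [psi_zero]
    · exact hpsi _ (by positivity)
  refine Measure.measurable_of_measurable_coe _ fun B hB => ?_
  have hinv : Measurable fun x => (weight x)⁻¹ := measurable_weight.inv
  have e : ∀ t, ν t B = ∫⁻ x, B.indicator (fun x => (weight x)⁻¹) x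
      ∂((weightedImage (ν t)).comap expNeg) := by
    intro t
    rw [lintegral_indicator hB, ← withDensity_apply _ hB, withDensity_comap_weightedImage]
  simp_rw [e]
  refine (Measure.measurable_lintegral (hinv.indicator hB)).comp
    (Measure.measurable_of_measurable_coe _ fun C hC => ?_)
  simp_rw [measurableEmbedding_expNeg.comap_apply]
  exact (Measure.measurable_coe (measurableEmbedding_expNeg.measurableSet_image.2 hC)).comp hw

/-! ### Burgers' equation by characteristics -/

theorem psi_le_mul_moment_of_nonneg {μ : Measure E} (h : moment 2 μ < ∞) {s : ℝ} (hs : 0 ≤ s) :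
    psi μ s ≤ s * (moment 2 μ).toReal := by
  rcases hs.eq_or_lt with rfl | hs
  · simp [psi_zero]
  · exact psi_le_mul_moment h hs

theorem continuousOn_psi {μ : Measure E} (h : moment 2 μ < ∞) : ContinuousOn (psi μ) (Ici 0) := by
  intro s hs
  rcases (mem_Ici.1 hs).eq_or_lt with rfl | hs
  · rw [← continuousWithinAt_Ioi_iff_Ici, ContinuousWithinAt, psi_zero]
    exact tendsto_psi_zero h
  · exact ((psiIntegrable_of_moment_lt_top h).hasDerivAt_psi hs).continuousAt.continuousWithinAt

theorem psi_sub_le {μ : Measure E} (h : moment 2 μ < ∞) {a b : ℝ} (ha : 0 < a) (hab : a ≤ b) :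
    psi μ b - psi μ a ≤ (moment 2 μ).toReal * (b - a) := by
  have hd := fun s hs => (psiIntegrable_of_moment_lt_top h).hasDerivAt_psi (s := s) hs
  refine (convex_Ioi (0 : ℝ)).image_sub_le_mul_sub_of_deriv_le
    (fun s hs => (hd s hs).continuousAt.continuousWithinAt)
    (fun s hs => (hd s (by simpa using hs)).differentiableAt.differentiableWithinAt)
    (fun s hs => ?_) a ha b (ha.trans_le hab) hab
  have hs : 0 < s := by simpa using hs
  rw [(hd s hs).deriv]
  exact lap_two_le_moment h hs.le

/-- With `dslope`, difference quotients and derivatives are bounded together. Differences of the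
implicit equation then become exact linear identities, free of any case distinction on coinciding
points. -/
theorem dslope_psi_mem_Icc {μ : Measure E} (h : moment 2 μ < ∞) {a b : ℝ} (ha : 0 < a)
    (hb : 0 < b) : dslope (psi μ) a b ∈ Icc 0 (moment 2 μ).toReal := by
  have hψ := psiIntegrable_of_moment_lt_top h
  have key : ∀ {a b : ℝ}, 0 < a → a < b → slope (psi μ) a b ∈ Icc 0 (moment 2 μ).toReal := by
    intro a b ha hab
    rw [slope_def_field]
    have h1 := hψ.psi_mono ha hab.le
    have h2 := psi_sub_le h ha hab.le
    exact ⟨div_nonneg (by linarith) (by linarith), (div_le_iff₀ (by linarith)).2 h2⟩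
  rcases lt_trichotomy a b with hab | rfl | hab
  · rw [dslope_of_ne _ hab.ne']; exact key ha hab
  · rw [dslope_same, (hψ.hasDerivAt_psi ha).deriv]
    exact ⟨lap_nonneg _ _ _, lap_two_le_moment h ha.le⟩
  · rw [dslope_of_ne _ hab.ne, slope_comm]; exact key hb hab

/-- The solution `c` of the implicit equation `c = ψ₀(s + t c)`, which solves Burgers' equation
with initial data `ψ₀ = psi μ`. -/
noncomputable def burgers (μ : Measure E) (t s : ℝ) : ℝ :=
  Classical.epsilon fun c => 0 ≤ c ∧ c = psi μ (s + t * c)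

theorem exists_burgers {μ : Measure E} (h : moment 2 μ < ∞) {t s : ℝ} (ht : 0 ≤ t)
    (htm : t * (moment 2 μ).toReal < 1) (hs : 0 ≤ s) : ∃ c, 0 ≤ c ∧ c = psi μ (s + t * c) := by
  set m := (moment 2 μ).toReal with hm
  have hm0 : 0 ≤ m := ENNReal.toReal_nonneg
  have h1 : 0 < 1 - t * m := by linarith
  -- The fixed point of `C = (s + t C) m`, the linear majorant of the implicit equation; there `ψ₀(s
  -- + t C) ≤ C`, so the intermediate value theorem applies on `[0, C]`.
  set C := s * m / (1 - t * m) with hC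
  have hC0 : 0 ≤ C := by positivity
  have hcont : ContinuousOn (fun c => c - psi μ (s + t * c)) (Icc 0 C) := by
    refine continuousOn_id.sub ((continuousOn_psi h).comp (by fun_prop) fun c hc => ?_)
    exact mem_Ici.2 (add_nonneg hs (mul_nonneg ht hc.1))
  have h2 : psi μ (s + t * C) ≤ C := by
    refine (psi_le_mul_moment_of_nonneg h (by positivity)).trans (le_of_eq ?_)
    rw [← hm, hC]
    field_simp
    ring
  obtain ⟨c, hc, hc0⟩ := intermediate_value_Icc hC0 hcont (show (0 : ℝ) ∈ _ from
    ⟨by simpa using psi_nonneg μ hs, by simpa using h2⟩)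
  exact ⟨c, hc.1, by simpa [sub_eq_zero] using hc0⟩

section

variable {μ : Measure E} (h : moment 2 μ < ∞) {t s : ℝ} (ht : 0 ≤ t)
  (htm : t * (moment 2 μ).toReal < 1)

include h ht htm

theorem burgers_nonneg (hs : 0 ≤ s) : 0 ≤ burgers μ t s :=
  (Classical.epsilon_spec (exists_burgers h ht htm hs)).1

theorem burgers_eq (hs : 0 ≤ s) : burgers μ t s = psi μ (s + t * burgers μ t s) :=
  (Classical.epsilon_spec (exists_burgers h ht htm hs)).2

theorem add_mul_burgers_pos (hs : 0 < s) : 0 < s + t * burgers μ t s :=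
  add_pos_of_pos_of_nonneg hs (mul_nonneg ht (burgers_nonneg h ht htm hs.le))

/-- Two roots satisfy `c' - c = t d (c' - c)`, where `d` is a divided difference of `ψ₀`, and `t d ≤
t m₂ < 1`. -/
theorem burgers_unique (hs : 0 < s) {c : ℝ} (hc0 : 0 ≤ c) (hc : c = psi μ (s + t * c)) :
    c = burgers μ t s := by
  have h1 := burgers_eq h ht htm hs.le
  have h2 := burgers_nonneg h ht htm hs.le
  set c' := burgers μ t s
  have h3 := dslope_psi_mem_Icc h (add_pos_of_pos_of_nonneg hs (mul_nonneg ht hc0))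
    (add_pos_of_pos_of_nonneg hs (mul_nonneg ht h2))
  have h4 := sub_smul_dslope (psi μ) (s + t * c) (s + t * c')
  rw [← hc, ← h1, smul_eq_mul] at h4
  set d := dslope (psi μ) (s + t * c) (s + t * c')
  have h5 : (c' - c) * (1 - t * d) = 0 := by linear_combination -h4
  have h6 : t * d < 1 := (mul_le_mul_of_nonneg_left h3.2 ht).trans_lt htm
  rcases mul_eq_zero.1 h5 with h7 | h7 <;> linarith

theorem burgers_le (hs : 0 ≤ s) :
    burgers μ t s ≤ s * ((moment 2 μ).toReal / (1 - t * (moment 2 μ).toReal)) := by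
  have h1 := burgers_eq h ht htm hs
  have h2 := burgers_nonneg h ht htm hs
  have h3 := psi_le_mul_moment_of_nonneg h (add_nonneg hs (mul_nonneg ht h2))
  rw [← h1] at h3
  rw [← mul_div_assoc, le_div_iff₀ (by linarith)]
  linarith

/-- Subtracting the implicit equations at `s'` and `s` gives exactly `c(s') - c(s) = d/(1 - t d) ·
(s' - s)`, with `d` the divided difference of `ψ₀` between the two feet of characteristics. Since `d
∈ [0, m₂]` this gives continuity of `c`; then `d` tends to the derivative of `ψ₀`. -/
theorem hasDerivAt_burgers (hs : 0 < s) :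
    HasDerivAt (burgers μ t) (lap 2 μ (s + t * burgers μ t s) /
      (1 - t * lap 2 μ (s + t * burgers μ t s))) s := by
  set m := (moment 2 μ).toReal
  have hm0 : 0 ≤ m := ENNReal.toReal_nonneg
  set η : ℝ → ℝ := fun s => s + t * burgers μ t s with hη
  have hη0 : ∀ s > 0, 0 < η s := fun s hs => add_mul_burgers_pos h ht htm hs
  have hψ := (psiIntegrable_of_moment_lt_top h).hasDerivAt_psi (hη0 s hs)
  have hd : ∀ s' > 0, dslope (psi μ) (η s) (η s') ∈ Icc 0 m :=
    fun s' hs' => dslope_psi_mem_Icc h (hη0 s hs) (hη0 s' hs')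
  have htd : ∀ s' > 0, 0 < 1 - t * dslope (psi μ) (η s) (η s') := fun s' hs' => by
    have := mul_le_mul_of_nonneg_left (hd s' hs').2 ht
    linarith
  have hid : ∀ s' > 0, burgers μ t s' - burgers μ t s = dslope (psi μ) (η s) (η s') /
      (1 - t * dslope (psi μ) (η s) (η s')) * (s' - s) := by
    intro s' hs'
    have h4 := sub_smul_dslope (psi μ) (η s) (η s')
    have e1 : psi μ (η s) = burgers μ t s := (burgers_eq h ht htm hs.le).symm
    have e2 : psi μ (η s') = burgers μ t s' := (burgers_eq h ht htm hs'.le).symm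
    rw [e1, e2, smul_eq_mul] at h4
    have h5 := (htd s' hs').ne'
    rw [div_mul_eq_mul_div, eq_div_iff h5]
    simp only [hη] at h4 ⊢
    linear_combination -h4
  have hpos : ∀ᶠ s' in 𝓝 s, 0 < s' := eventually_gt_nhds hs
  have hcont : Tendsto (burgers μ t) (𝓝 s) (𝓝 (burgers μ t s)) := by
    rw [tendsto_iff_norm_sub_tendsto_zero]
    have h1 : Tendsto (fun s' => m / (1 - t * m) * |s' - s|) (𝓝 s) (𝓝 0) := by
      have : Tendsto (fun s' => m / (1 - t * m) * |s' - s|) (𝓝 s)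
          (𝓝 (m / (1 - t * m) * |s - s|)) :=
        Continuous.tendsto (by fun_prop) s
      simpa using this
    refine squeeze_zero' (Eventually.of_forall fun _ => norm_nonneg _) ?_ h1
    filter_upwards [hpos] with s' hs'
    have h2 := htd s' hs'
    have h3 := hd s' hs'
    rw [hid s' hs', Real.norm_eq_abs, abs_mul, abs_of_nonneg (div_nonneg h3.1 h2.le)]
    refine mul_le_mul_of_nonneg_right (div_le_div₀ hm0 h3.2 (by linarith) ?_) (abs_nonneg _)
    have := mul_le_mul_of_nonneg_left h3.2 ht
    linarith
  have hηc : Tendsto η (𝓝 s) (𝓝 (η s)) := tendsto_id.add (hcont.const_mul t)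
  have hdc : Tendsto (fun s' => dslope (psi μ) (η s) (η s')) (𝓝 s) (𝓝 (lap 2 μ (η s))) := by
    have h1 : ContinuousAt (dslope (psi μ) (η s)) (η s) :=
      continuousAt_dslope_same.2 hψ.differentiableAt
    have h2 := h1.tendsto.comp hηc
    rwa [dslope_same, hψ.deriv] at h2
  have hne : 1 - t * lap 2 μ (η s) ≠ 0 := by
    have := htd s hs
    rw [dslope_same, hψ.deriv] at this
    exact this.ne'
  rw [hasDerivAt_iff_tendsto_slope]
  have h1 := hdc.div ((hdc.const_mul t).const_sub 1) hne
  refine (h1.mono_left nhdsWithin_le_nhds).congr' ?_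
  filter_upwards [nhdsWithin_le_nhds hpos, self_mem_nhdsWithin] with s' hs' hne'
  rw [slope_def_field, hid s' hs', mul_div_assoc, div_self (sub_ne_zero.2 hne'), mul_one]
  rfl

/-- The same identity in the time variable; the feet now differ by `r (c_r - c_t) + (r - t) c_t`,
whence the extra factor `c_t`. -/
theorem hasDerivWithinAt_burgers (hs : 0 < s) :
    HasDerivWithinAt (fun r => burgers μ r s)
      (burgers μ t s * (lap 2 μ (s + t * burgers μ t s) /
        (1 - t * lap 2 μ (s + t * burgers μ t s))))
      {r | 0 ≤ r ∧ r * (moment 2 μ).toReal < 1} t := by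
  set m := (moment 2 μ).toReal
  have hm0 : 0 ≤ m := ENNReal.toReal_nonneg
  set I : Set ℝ := {r | 0 ≤ r ∧ r * m < 1}
  set η : ℝ → ℝ := fun r => s + r * burgers μ r s with hη
  have hη0 : ∀ r ∈ I, 0 < η r := fun r hr => add_mul_burgers_pos h hr.1 hr.2 hs
  have htI : t ∈ I := ⟨ht, htm⟩
  have hψ := (psiIntegrable_of_moment_lt_top h).hasDerivAt_psi (hη0 t htI)
  have hd : ∀ r ∈ I, dslope (psi μ) (η t) (η r) ∈ Icc 0 m :=
    fun r hr => dslope_psi_mem_Icc h (hη0 t htI) (hη0 r hr)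
  have htd : ∀ r ∈ I, 0 < 1 - r * dslope (psi μ) (η t) (η r) := fun r hr => by
    have := mul_le_mul_of_nonneg_left (hd r hr).2 hr.1
    linarith [hr.2]
  have hid : ∀ r ∈ I, burgers μ r s - burgers μ t s = burgers μ t s *
      (dslope (psi μ) (η t) (η r) / (1 - r * dslope (psi μ) (η t) (η r))) * (r - t) := by
    intro r hr
    have h4 := sub_smul_dslope (psi μ) (η t) (η r)
    have e1 : psi μ (η t) = burgers μ t s := (burgers_eq h ht htm hs.le).symm
    have e2 : psi μ (η r) = burgers μ r s := (burgers_eq h hr.1 hr.2 hs.le).symm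
    rw [e1, e2, smul_eq_mul] at h4
    have h5 := (htd r hr).ne'
    rw [mul_assoc, div_mul_eq_mul_div, mul_div_assoc', eq_div_iff h5]
    simp only [hη] at h4 ⊢
    linear_combination -h4
  have hc0 := burgers_nonneg h ht htm hs.le
  have hcont : Tendsto (fun r => burgers μ r s) (𝓝[I] t) (𝓝 (burgers μ t s)) := by
    rw [tendsto_iff_norm_sub_tendsto_zero]
    have h1 : Tendsto (fun r => burgers μ t s * (m / (1 - r * m)) * |r - t|) (𝓝[I] t) (𝓝 0) := by
      have : ContinuousAt (fun r => burgers μ t s * (m / (1 - r * m)) * |r - t|) t := by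
        have : 1 - t * m ≠ 0 := by linarith
        fun_prop (disch := assumption)
      simpa using this.tendsto.mono_left (nhdsWithin_le_nhds (s := I))
    refine squeeze_zero' (Eventually.of_forall fun _ => norm_nonneg _) ?_ h1
    filter_upwards [self_mem_nhdsWithin] with r hr
    have h2 := htd r hr
    have h3 := hd r hr
    rw [hid r hr, Real.norm_eq_abs, abs_mul, abs_of_nonneg (mul_nonneg hc0 (div_nonneg h3.1 h2.le))]
    refine mul_le_mul_of_nonneg_right (mul_le_mul_of_nonneg_left
      (div_le_div₀ hm0 h3.2 (by linarith [hr.2]) ?_) hc0) (abs_nonneg _)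
    have := mul_le_mul_of_nonneg_left h3.2 hr.1
    linarith
  have hidt : Tendsto (fun r : ℝ => r) (𝓝[I] t) (𝓝 t) := tendsto_id.mono_left nhdsWithin_le_nhds
  have hηc : Tendsto η (𝓝[I] t) (𝓝 (η t)) := (hidt.mul hcont).const_add s
  have hdc : Tendsto (fun r => dslope (psi μ) (η t) (η r)) (𝓝[I] t) (𝓝 (lap 2 μ (η t))) := by
    have h1 : ContinuousAt (dslope (psi μ) (η t)) (η t) :=
      continuousAt_dslope_same.2 hψ.differentiableAt
    have h2 := h1.tendsto.comp hηc
    rwa [dslope_same, hψ.deriv] at h2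
  have hne : 1 - t * lap 2 μ (η t) ≠ 0 := by
    have := htd t htI
    rw [dslope_same, hψ.deriv] at this
    exact this.ne'
  rw [hasDerivWithinAt_iff_tendsto_slope]
  have h1 := (hdc.div ((hidt.mul hdc).const_sub 1) hne).const_mul (burgers μ t s)
  refine (h1.mono_left (nhdsWithin_mono _ sdiff_subset)).congr' ?_
  filter_upwards [self_mem_nhdsWithin] with r hr
  rw [slope_def_field, hid r hr.1, mul_div_assoc, div_self (sub_ne_zero.2 hr.2), mul_one]
  rfl

theorem one_sub_mul_lap_two_pos (hs : 0 ≤ s) : 0 < 1 - t * lap 2 μ s := by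
  have := mul_le_mul_of_nonneg_left (lap_two_le_moment h hs) ht
  linarith

/-- Minus the derivative is `t · lap 3 μ` times the square of the function itself, so the order
rises by induction through products. -/
theorem isCM_one_div_one_sub_lap (n : ℕ) : IsCM n (fun s => 1 / (1 - t * lap 2 μ s)) := by
  have hψ := psiIntegrable_of_moment_lt_top h
  have h0 : ∀ s > 0, 0 ≤ 1 / (1 - t * lap 2 μ s) := fun s hs =>
    one_div_nonneg.2 (one_sub_mul_lap_two_pos h ht htm (le_of_lt hs)).le
  induction n with
  | zero => exact h0
  | succ n ih =>
    refine ⟨h0, fun s => t * lap 3 μ s * (1 / (1 - t * lap 2 μ s) * (1 / (1 - t * lap 2 μ s))),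
      fun s hs => ?_, ((hψ.isCM_lap n (by norm_num)).const_mul ht).mul (ih.mul ih)⟩
    have hne := (one_sub_mul_lap_two_pos h ht htm (le_of_lt hs)).ne'
    have h1 := (((hψ.hasDerivAt_lap hs le_rfl).const_mul t).const_sub 1).inv hne
    simp only [one_div]
    refine h1.congr_deriv ?_
    field_simp

/-- The foot `η = s + t c` obeys the autonomous equation `η' = G ∘ η` with `G = 1/(1 - t · lap 2
μ)`, so `comp_of_ode` makes `η'` completely monotone. The function in question is `(lap 2 μ · G) ∘
η`. -/
theorem isCM_deriv_burgers (n : ℕ) :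
    IsCM n (fun s => lap 2 μ (s + t * burgers μ t s) /
      (1 - t * lap 2 μ (s + t * burgers μ t s))) := by
  have hη : ∀ s > 0, 0 < s + t * burgers μ t s := fun s hs => add_mul_burgers_pos h ht htm hs
  have hd : ∀ s > 0, HasDerivAt (fun s => s + t * burgers μ t s)
      (1 / (1 - t * lap 2 μ (s + t * burgers μ t s))) s := by
    intro s hs
    refine ((hasDerivAt_id s).add ((hasDerivAt_burgers h ht htm hs).const_mul t)).congr_deriv ?_
    have hne := (one_sub_mul_lap_two_pos h ht htm (hη s hs).le).ne'
    field_simp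
    ring
  have hG := isCM_one_div_one_sub_lap h ht htm
  have h1 := IsCM.comp_of_ode hG hη hd
  have h2 : IsCM (n + 1) (fun s => lap 2 μ s * (1 / (1 - t * lap 2 μ s))) :=
    ((psiIntegrable_of_moment_lt_top h).isCM_lap _ le_rfl).mul (hG _)
  have h3 := (h2.comp (h1 n) hη hd).of_succ
  simpa only [mul_one_div] using h3

theorem burgers_zero_right : burgers μ t 0 = 0 := by
  have h1 := burgers_nonneg h ht htm le_rfl
  have h2 := burgers_le h ht htm le_rfl
  linarith

theorem continuousOn_add_mul_burgers :
    ContinuousOn (fun s => s + t * burgers μ t s) (Ici 0) := by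
  refine continuousOn_id.add (continuousOn_const.mul fun s hs => ?_)
  rcases (mem_Ici.1 hs).eq_or_lt with rfl | hs
  · rw [ContinuousWithinAt, burgers_zero_right h ht htm]
    have h1 : Tendsto (fun s => s * ((moment 2 μ).toReal / (1 - t * (moment 2 μ).toReal)))
        (𝓝[≥] 0) (𝓝 0) := by
      have : Tendsto (fun s => s * ((moment 2 μ).toReal / (1 - t * (moment 2 μ).toReal)))
        (𝓝 0) (𝓝 (0 * ((moment 2 μ).toReal / (1 - t * (moment 2 μ).toReal)))) :=
          tendsto_id.mul_const _
      rw [zero_mul] at this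
      exact this.mono_left nhdsWithin_le_nhds
    exact squeeze_zero' (eventually_nhdsWithin_of_forall fun s hs => burgers_nonneg h ht htm hs)
      (eventually_nhdsWithin_of_forall fun s hs => burgers_le h ht htm hs) h1
  · exact (hasDerivAt_burgers h ht htm hs).continuousAt.continuousWithinAt

theorem continuousOn_deriv_burgers :
    ContinuousOn (fun s => lap 2 μ (s + t * burgers μ t s) /
      (1 - t * lap 2 μ (s + t * burgers μ t s))) (Ici 0) := by
  have hη : ∀ s ∈ Ici (0 : ℝ), 0 ≤ s + t * burgers μ t s := fun s hs =>
    add_nonneg hs (mul_nonneg ht (burgers_nonneg h ht htm hs))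
  have h1 : ContinuousOn (fun s => lap 2 μ (s + t * burgers μ t s)) (Ici 0) :=
    (continuousOn_lap_two h).comp (continuousOn_add_mul_burgers h ht htm) hη
  exact h1.div (continuousOn_const.sub (continuousOn_const.mul h1))
    fun s hs => (one_sub_mul_lap_two_pos h ht htm (hη s hs)).ne'

theorem tendsto_deriv_burgers_atTop :
    Tendsto (fun s => lap 2 μ (s + t * burgers μ t s) /
      (1 - t * lap 2 μ (s + t * burgers μ t s))) atTop (𝓝 0) := by
  have h1 : Tendsto (fun s => s + t * burgers μ t s) atTop atTop := by
    refine tendsto_atTop_mono' atTop ?_ tendsto_id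
    filter_upwards [eventually_ge_atTop 0] with s hs
    exact le_add_of_nonneg_right (mul_nonneg ht (burgers_nonneg h ht htm hs))
  have h2 := (tendsto_lap_two_atTop h).comp h1
  have h3 := h2.div ((h2.const_mul t).const_sub 1) (by norm_num)
  rw [mul_zero, sub_zero, zero_div] at h3
  exact h3

/-- The solution of Burgers' equation is, at each time, the transform of a measure. -/
theorem exists_measure_psi_eq_burgers :
    ∃ ν : Measure E, moment 2 ν ≤ ENNReal.ofReal
        ((moment 2 μ).toReal / (1 - t * (moment 2 μ).toReal)) ∧
      ∀ s > 0, psi ν s = burgers μ t s := by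
  obtain ⟨ρ, hρ0, hρ⟩ := exists_measure_laplace_eq (isCM_deriv_burgers h ht htm)
    (continuousOn_deriv_burgers h ht htm) (tendsto_deriv_burgers_atTop h ht htm)
  have hw : Measurable fun x : E => (ENNReal.ofReal ((x : ℝ) ^ 2))⁻¹ := by fun_prop
  have hx : ∀ x : E, 0 < (x : ℝ) ^ 2 := fun x => pow_pos x.2 2
  -- The measure `ρ` represents `∂ₛψ = ∫ e^{-s x} x² dν`, so `x²` is divided out; the second moment
  -- of `ν` is then the mass of `ρ`.
  set ν := ρ.withDensity fun x : E => (ENNReal.ofReal ((x : ℝ) ^ 2))⁻¹ with hν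
  have hmom : moment 2 ν = ρ univ := by
    rw [moment, hν, lintegral_withDensity_eq_lintegral_mul _ hw (by fun_prop), ← lintegral_one]
    refine lintegral_congr fun x => ?_
    simp only [Pi.mul_apply]
    exact ENNReal.inv_mul_cancel (by simpa using x.2.ne') ENNReal.ofReal_ne_top
  have hle : moment 2 ν ≤ ENNReal.ofReal
      ((moment 2 μ).toReal / (1 - t * (moment 2 μ).toReal)) := by
    rw [hmom]
    refine hρ0.trans (ENNReal.ofReal_le_ofReal ?_)
    rw [burgers_zero_right h ht htm, mul_zero, add_zero]
    have h1 := lap_two_le_moment h (le_refl (0 : ℝ))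
    refine div_le_div₀ ENNReal.toReal_nonneg h1 (by linarith) ?_
    have := mul_le_mul_of_nonneg_left h1 ht
    linarith
  have hlt : moment 2 ν < ∞ := hle.trans_lt ENNReal.ofReal_lt_top
  refine ⟨ν, hle, ?_⟩
  have hψ := psiIntegrable_of_moment_lt_top hlt
  have hlap : ∀ s > 0, lap 2 ν s = lap 2 μ (s + t * burgers μ t s) /
      (1 - t * lap 2 μ (s + t * burgers μ t s)) := by
    intro s hs
    rw [← hρ s hs, lap, hν, integral_withDensity_eq_integral_toReal_smul hw
      (Eventually.of_forall fun x => ENNReal.inv_lt_top.2 (ENNReal.ofReal_pos.2 (hx x)))]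
    refine integral_congr_ae (Eventually.of_forall fun x => ?_)
    simp only [smul_eq_mul, ENNReal.toReal_inv, ENNReal.toReal_ofReal (hx x).le]
    have hx0 : (0 : ℝ) < x := x.2
    field_simp
  -- Both functions have the same `s`-derivative, so they differ by a constant, which is `0` since
  -- both vanish as `s ↓ 0`.
  have hderiv : ∀ s > 0, HasDerivAt (fun s => psi ν s - burgers μ t s) 0 s := fun s hs =>
    ((hψ.hasDerivAt_psi hs).sub (hasDerivAt_burgers h ht htm hs)).congr_deriv
      (by rw [hlap s hs, sub_self])
  have hlim : Tendsto (fun s => psi ν s - burgers μ t s) (𝓝[>] 0) (𝓝 0) := by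
    have h1 : Tendsto (burgers μ t) (𝓝[>] 0) (𝓝 0) := by
      have h2 := continuousOn_add_mul_burgers h ht htm
      have h1 : Tendsto (fun s => s * ((moment 2 μ).toReal / (1 - t * (moment 2 μ).toReal)))
          (𝓝[>] 0) (𝓝 0) := by
        have : Tendsto (fun s => s * ((moment 2 μ).toReal / (1 - t * (moment 2 μ).toReal)))
          (𝓝 0) (𝓝 (0 * ((moment 2 μ).toReal / (1 - t * (moment 2 μ).toReal)))) :=
            tendsto_id.mul_const _
        rw [zero_mul] at this
        exact this.mono_left nhdsWithin_le_nhds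
      exact squeeze_zero' (eventually_nhdsWithin_of_forall fun s hs =>
          burgers_nonneg h ht htm (mem_Ioi.1 hs).le)
        (eventually_nhdsWithin_of_forall fun s hs => burgers_le h ht htm (mem_Ioi.1 hs).le) h1
    simpa using (tendsto_psi_zero hlt).sub h1
  intro s hs
  have hconst : ∀ r ∈ Ioi (0 : ℝ), psi ν r - burgers μ t r = psi ν s - burgers μ t s := fun r hr =>
    isOpen_Ioi.is_const_of_deriv_eq_zero isPreconnected_Ioi
      (fun x hx => (hderiv x hx).differentiableAt.differentiableWithinAt)
      (fun x hx => (hderiv x hx).deriv) hr hs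
  have h4 : Tendsto (fun s => psi ν s - burgers μ t s) (𝓝[>] 0)
      (𝓝 (psi ν s - burgers μ t s)) :=
    tendsto_const_nhds.congr' (eventually_nhdsWithin_of_forall fun r hr => (hconst r hr).symm)
  exact sub_eq_zero.1 (tendsto_nhds_unique h4 hlim)

end

/-! ### Test functions and their approximation by exponential sums -/

/-- Bounds on `f` and on its coagulation increment, uniform in the cluster sizes. -/
structure Tame (D : ℝ) (f : ℝ → ℝ) : Prop where
  measurable : Measurable fun x : E => f x
  abs_le : ∀ x > 0, |f x| ≤ D * x ^ 2
  abs_increment_le : ∀ x > 0, ∀ y > 0, |f (x + y) - f x - f y| ≤ 2 * D * (x * y)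

/-- With `f = x q` the increment is `x (q(x+y) - q(x)) + y (q(x+y) - q(y))`, and a Lipschitz bound
on `q` makes each term at most `D x y`. So test functions are to be approximated in the sup norm of
`(f/x)'`. -/
theorem tame_of_abs_deriv_le {f q q' : ℝ → ℝ} {D : ℝ} (hf : ∀ x > 0, f x = x * q x)
    (hq : ∀ x > 0, HasDerivAt q (q' x) x) (hq0 : Tendsto q (𝓝[>] 0) (𝓝 0))
    (hD : ∀ x > 0, |q' x| ≤ D) : Tame D f := by
  have hlip : ∀ x > 0, ∀ y > 0, |q y - q x| ≤ D * |y - x| := fun x hx y hy =>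
    (convex_Ioi (0 : ℝ)).norm_image_sub_le_of_norm_hasDerivWithin_le
      (fun z hz => (hq z hz).hasDerivWithinAt) (fun z hz => hD z hz) hx hy
  have habs : ∀ x > 0, |q x| ≤ D * x := by
    intro x hx
    have h1 : Tendsto (fun y => |q x - q y|) (𝓝[>] 0) (𝓝 |q x - 0|) := (hq0.const_sub (q x)).abs
    have h2 : Tendsto (fun y : ℝ => D * |x - y|) (𝓝[>] 0) (𝓝 (D * |x - 0|)) :=
      (Continuous.tendsto (by fun_prop) 0).mono_left nhdsWithin_le_nhds
    have h3 := le_of_tendsto_of_tendsto h1 h2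
      (eventually_nhdsWithin_of_forall fun y hy => hlip y hy x hx)
    simpa [abs_of_pos hx] using h3
  refine ⟨?_, fun x hx => ?_, fun x hx y hy => ?_⟩
  · have h1 : Continuous fun x : E => (x : ℝ) * q x := by
      refine continuous_subtype_val.mul ?_
      exact ContinuousOn.domRestrict (s := Ioi (0 : ℝ)) fun x hx =>
        (hq x hx).continuousAt.continuousWithinAt
    rw [show (fun x : E => f x) = fun x : E => (x : ℝ) * q x from funext fun x => hf x x.2]
    exact h1.measurable
  · rw [hf x hx, abs_mul, abs_of_pos hx]
    nlinarith [habs x hx]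
  · have hxy : 0 < x + y := add_pos hx hy
    rw [hf _ hxy, hf x hx, hf y hy, show (x + y) * q (x + y) - x * q x - y * q y
      = x * (q (x + y) - q x) + y * (q (x + y) - q y) by ring]
    have h1 := hlip x hx _ hxy
    have h2 := hlip y hy _ hxy
    rw [show x + y - x = y by ring, abs_of_pos hy] at h1
    rw [show x + y - y = x by ring, abs_of_pos hx] at h2
    refine (abs_add_le _ _).trans ?_
    rw [abs_mul, abs_mul, abs_of_pos hx, abs_of_pos hy]
    nlinarith

/-- Linear combinations of the functions `x (1 - e^{-k x})`, `k ≥ 1`. -/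
noncomputable def expSum (n : ℕ) (a : ℕ → ℝ) (x : ℝ) : ℝ :=
  ∑ i ∈ Finset.range n, a i * ((1 - Real.exp (-((i : ℝ) + 1) * x)) * x)

namespace IsTestFunction

variable {f : ℝ → ℝ} (hf : IsTestFunction 2 f)

include hf

theorem hasDerivAt {x : ℝ} (hx : 0 < x) : HasDerivAt f (deriv f x) x :=
  ((hf.contDiffOn.contDiffAt (Ioi_mem_nhds hx)).differentiableAt (by norm_num)).hasDerivAt

theorem hasDerivAt_deriv {x : ℝ} (hx : 0 < x) : HasDerivAt (deriv f) (iteratedDeriv 2 f x) x := by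
  have h1 : ContDiffAt ℝ 2 f x := hf.contDiffOn.contDiffAt (Ioi_mem_nhds hx)
  have h2 : DifferentiableAt ℝ (deriv f) x :=
    (h1.derivWithin (m := 1) one_add_one_eq_two.le).differentiableAt (by norm_num)
  rw [iteratedDeriv_succ, iteratedDeriv_one]
  exact h2.hasDerivAt

theorem tendsto_zero : Tendsto f (𝓝[>] 0) (𝓝 0) := by
  simpa using hf.vanish_zero 0 (by norm_num)

theorem tendsto_deriv_zero : Tendsto (deriv f) (𝓝[>] 0) (𝓝 0) := by
  simpa using hf.vanish_zero 1 (by norm_num)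

/-- The function here is `(f/x)'`. Since `f` and `f'` vanish at `0`, l'Hôpital's rule gives limits
`a` for `f'/x` and `a/2` for `f/x²`, with `a` the limit of `f''`. -/
theorem exists_tendsto_deriv_div_zero :
    ∃ a, Tendsto (fun x => deriv f x / x - f x / x ^ 2) (𝓝[>] 0) (𝓝 a) := by
  obtain ⟨a, ha⟩ := hf.limit_zero 2 le_rfl
  have hid : Tendsto (fun x : ℝ => x) (𝓝[>] 0) (𝓝 0) := tendsto_id.mono_left nhdsWithin_le_nhds
  have h1 : Tendsto (fun x => deriv f x / x) (𝓝[>] 0) (𝓝 a) := by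
    refine HasDerivAt.lhopital_zero_nhdsGT (f' := iteratedDeriv 2 f) (g' := fun _ => 1)
      (eventually_nhdsWithin_of_forall fun x hx => hf.hasDerivAt_deriv hx)
      (eventually_nhdsWithin_of_forall fun x hx => hasDerivAt_id x)
      (Eventually.of_forall fun _ => one_ne_zero) hf.tendsto_deriv_zero hid ?_
    simpa using ha
  have h2 : Tendsto (fun x => f x / x ^ 2) (𝓝[>] 0) (𝓝 (a / 2)) := by
    refine HasDerivAt.lhopital_zero_nhdsGT (f' := deriv f) (g' := fun x => 2 * x)
      (eventually_nhdsWithin_of_forall fun x hx => hf.hasDerivAt hx)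
      (eventually_nhdsWithin_of_forall fun x hx => by simpa using hasDerivAt_pow 2 x)
      (eventually_nhdsWithin_of_forall fun x hx => mul_ne_zero two_ne_zero (mem_Ioi.1 hx).ne')
      hf.tendsto_zero (by simpa using hid.pow 2) ?_
    refine (h1.div_const 2).congr fun x => ?_
    rw [div_div, mul_comm]
  exact ⟨_, h1.sub h2⟩

theorem tendsto_deriv_div_atTop :
    Tendsto (fun x => deriv f x / x - f x / x ^ 2) atTop (𝓝 0) := by
  obtain ⟨a, ha⟩ := hf.limit_top 0 (by norm_num)
  obtain ⟨b, hb⟩ := hf.limit_top 1 (by norm_num)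
  rw [iteratedDeriv_zero] at ha
  rw [iteratedDeriv_one] at hb
  have h1 := hb.div_atTop tendsto_id
  have h2 := ha.div_atTop (tendsto_pow_atTop (α := ℝ) (n := 2) two_ne_zero)
  simpa using h1.sub h2

theorem hasDerivAt_div {x : ℝ} (hx : 0 < x) :
    HasDerivAt (fun x => f x / x) (deriv f x / x - f x / x ^ 2) x := by
  refine ((hf.hasDerivAt hx).div (hasDerivAt_id x) hx.ne').congr_deriv ?_
  simp only [id]
  field_simp

theorem tendsto_div_zero : Tendsto (fun x => f x / x) (𝓝[>] 0) (𝓝 0) := by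
  refine HasDerivAt.lhopital_zero_nhdsGT (f' := deriv f) (g' := fun _ => 1)
      (eventually_nhdsWithin_of_forall fun x hx => hf.hasDerivAt hx)
      (eventually_nhdsWithin_of_forall fun x hx => hasDerivAt_id x)
      (Eventually.of_forall fun _ => one_ne_zero) hf.tendsto_zero
      (tendsto_id.mono_left nhdsWithin_le_nhds) ?_
  simpa using hf.tendsto_deriv_zero

/-- In the variable `u = e^{-x}` the function `(f/x)'` extends continuously to `[0, 1]`, with value
`0` at `u = 0`, and Weierstrass' theorem applies. -/
theorem exists_exp_approx {ε : ℝ} (hε : 0 < ε) : ∃ (n : ℕ) (b : ℕ → ℝ), ∀ x > 0,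
    |(deriv f x / x - f x / x ^ 2)
      - ∑ i ∈ Finset.range n, b i * Real.exp (-((i : ℝ) + 1) * x)| ≤ ε := by
  set r : ℝ → ℝ := fun x => deriv f x / x - f x / x ^ 2 with hr
  set h : ℝ → ℝ := fun u => r (-Real.log u) with hh
  obtain ⟨a, ha⟩ := hf.exists_tendsto_deriv_div_zero
  have hrc : ContinuousOn r (Ioi 0) := by
    intro x hx
    have hx0 : x ≠ 0 := (mem_Ioi.1 hx).ne'
    have h1 := (hf.hasDerivAt hx).continuousAt
    have h2 := (hf.hasDerivAt_deriv hx).continuousAt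
    exact ((h2.div continuousAt_id hx0).sub
      (h1.div (continuousAt_id.pow 2) (pow_ne_zero 2 hx0))).continuousWithinAt
  have hc : ContinuousOn h (Ioo 0 1) := by
    refine hrc.comp (ContinuousOn.neg ?_) fun u hu => ?_
    · exact Real.continuousOn_log.mono fun u hu => (ne_of_gt hu.1)
    · simpa using Real.log_neg hu.1 hu.2
  have h0 : Tendsto h (𝓝[>] 0) (𝓝 0) := by
    have : Tendsto (fun u => -Real.log u) (𝓝[>] 0) atTop :=
      tendsto_neg_atBot_atTop.comp Real.tendsto_log_nhdsGT_zero
    exact hf.tendsto_deriv_div_atTop.comp this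
  have h1 : Tendsto h (𝓝[<] 1) (𝓝 a) := by
    refine ha.comp (tendsto_nhdsWithin_iff.2 ⟨?_, ?_⟩)
    · have : Tendsto (fun u => -Real.log u) (𝓝 1) (𝓝 (-Real.log 1)) :=
        (Real.continuousAt_log one_ne_zero).neg
      rw [Real.log_one, neg_zero] at this
      exact this.mono_left nhdsWithin_le_nhds
    · filter_upwards [self_mem_nhdsWithin, nhdsWithin_le_nhds (eventually_gt_nhds zero_lt_one)]
        with u hu hu0
      simpa using Real.log_neg hu0 hu
  have hext := continuousOn_Icc_extendFrom_Ioo hc h0 h1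
  have hext0 := eq_lim_at_left_extendFrom_Ioo zero_lt_one h0
  obtain ⟨p, hp⟩ := exists_polynomial_near_of_continuousOn 0 1 _ hext (ε / 2) (half_pos hε)
  have hp0 := hp 0 (left_mem_Icc.2 zero_le_one)
  rw [hext0, sub_zero] at hp0
  -- The constant term of `p` is its value at `u = 0`, less than `ε / 2` in size; discarding it
  -- costs the second half of `ε`.
  refine ⟨p.natDegree, fun i => p.coeff (i + 1), fun x hx => ?_⟩
  have hu : Real.exp (-x) ∈ Ioo (0 : ℝ) 1 :=
    ⟨Real.exp_pos _, Real.exp_lt_one_iff.2 (by linarith)⟩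
  have hpu := hp (Real.exp (-x)) (Ioo_subset_Icc_self hu)
  have hval : extendFrom (Ioo 0 1) h (Real.exp (-x)) = r x := by
    rw [extendFrom_extends hc _ hu, hh]
    simp
  rw [hval, Polynomial.eval_eq_sum_range, Finset.sum_range_succ'] at hpu
  have hp00 : Polynomial.eval 0 p = p.coeff 0 := (Polynomial.coeff_zero_eq_eval_zero p).symm
  rw [hp00] at hp0
  have hexp : ∀ i : ℕ, Real.exp (-x) ^ (i + 1) = Real.exp (-((i : ℝ) + 1) * x) := by
    intro i
    rw [← Real.exp_nat_mul]
    congr 1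
    push_cast
    ring
  simp_rw [hexp] at hpu
  rw [pow_zero, mul_one] at hpu
  rw [abs_lt] at hpu hp0
  rw [abs_le]
  constructor <;> linarith [hpu.1, hpu.2, hp0.1, hp0.2]

theorem exists_tame_sub_expSum {ε : ℝ} (hε : 0 < ε) :
    ∃ (n : ℕ) (a : ℕ → ℝ), Tame ε (fun x => f x - expSum n a x) := by
  obtain ⟨n, b, hb⟩ := hf.exists_exp_approx hε
  -- Integrating `b e^{-(i+1) x}` from `0` gives `b/(i+1) · (1 - e^{-(i+1) x})`.
  refine ⟨n, fun i => b i / (i + 1), ?_⟩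
  refine tame_of_abs_deriv_le
    (q := fun x => f x / x
      - ∑ i ∈ Finset.range n, b i / (i + 1) * (1 - Real.exp (-((i : ℝ) + 1) * x)))
    (q' := fun x => (deriv f x / x - f x / x ^ 2)
      - ∑ i ∈ Finset.range n, b i * Real.exp (-((i : ℝ) + 1) * x)) ?_ ?_ ?_ hb
  · intro x hx
    rw [mul_sub, mul_div_cancel₀ _ hx.ne', expSum, Finset.mul_sum]
    congr 1
    exact Finset.sum_congr rfl fun i _ => by ring
  · intro x hx
    refine (hf.hasDerivAt_div hx).sub (HasDerivAt.fun_sum fun i _ => ?_)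
    have h1 : HasDerivAt (fun x => Real.exp (-((i : ℝ) + 1) * x))
        (Real.exp (-((i : ℝ) + 1) * x) * (-((i : ℝ) + 1) * 1)) x :=
      ((hasDerivAt_id x).const_mul _).exp
    refine ((h1.const_sub 1).const_mul (b i / (i + 1))).congr_deriv ?_
    have : (i : ℝ) + 1 ≠ 0 := by positivity
    field_simp
  · have h1 : Tendsto (fun x : ℝ => ∑ i ∈ Finset.range n,
        b i / (i + 1) * (1 - Real.exp (-((i : ℝ) + 1) * x))) (𝓝[>] 0) (𝓝 0) := by
      have : Continuous (fun x : ℝ => ∑ i ∈ Finset.range n,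
        b i / (i + 1) * (1 - Real.exp (-((i : ℝ) + 1) * x))) := by fun_prop
      simpa using (this.tendsto 0).mono_left nhdsWithin_le_nhds
    simpa using hf.tendsto_div_zero.sub h1

end IsTestFunction

theorem exists_tame_expSum (n : ℕ) (a : ℕ → ℝ) : ∃ D, Tame D (expSum n a) := by
  refine ⟨∑ i ∈ Finset.range n, |a i| * (i + 1), tame_of_abs_deriv_le
    (q := fun x => ∑ i ∈ Finset.range n, a i * (1 - Real.exp (-((i : ℝ) + 1) * x)))
    (q' := fun x => ∑ i ∈ Finset.range n, a i * (((i : ℝ) + 1) * Real.exp (-((i : ℝ) + 1) * x)))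
    ?_ ?_ ?_ ?_⟩
  · intro x _
    rw [expSum, Finset.mul_sum]
    exact Finset.sum_congr rfl fun i _ => by ring
  · intro x hx
    refine HasDerivAt.fun_sum fun i _ => ?_
    have h1 : HasDerivAt (fun x => Real.exp (-((i : ℝ) + 1) * x))
        (Real.exp (-((i : ℝ) + 1) * x) * (-((i : ℝ) + 1) * 1)) x :=
      ((hasDerivAt_id x).const_mul _).exp
    exact ((h1.const_sub 1).const_mul (a i)).congr_deriv (by ring)
  · have : Continuous (fun x : ℝ => ∑ i ∈ Finset.range n,
        a i * (1 - Real.exp (-((i : ℝ) + 1) * x))) := by fun_prop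
    simpa using (this.tendsto 0).mono_left nhdsWithin_le_nhds
  · intro x hx
    refine (Finset.abs_sum_le_sum_abs _ _).trans (Finset.sum_le_sum fun i _ => ?_)
    have h1 : Real.exp (-((i : ℝ) + 1) * x) ≤ 1 := Real.exp_le_one_iff.2 (by nlinarith [hx.le])
    rw [abs_mul, abs_of_nonneg (show (0 : ℝ) ≤ (i + 1) * Real.exp (-((i : ℝ) + 1) * x) by positivity)]
    exact mul_le_mul_of_nonneg_left (mul_le_of_le_one_right (by positivity) h1) (abs_nonneg _)

/-! ### The coagulation operator on exponential sums and tame functions -/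

/-- The convention `0⁻¹ = ∞` covers the zero measure: both sides then reduce to `0 ≤ t`. -/
theorem mem_timeInterval_inv_iff {M : ℝ≥0∞} (hM : M < ∞) {t : ℝ} :
    t ∈ timeInterval M⁻¹ ↔ 0 ≤ t ∧ t * M.toReal < 1 := by
  refine and_congr_right fun ht => ?_
  rcases eq_or_ne M 0 with rfl | h0
  · simp
  · have hm : 0 < M.toReal := ENNReal.toReal_pos h0 hM.ne
    rw [ENNReal.ofReal_lt_iff_lt_toReal ht (ENNReal.inv_ne_top.2 h0), ENNReal.toReal_inv,
      ← one_div, lt_div_iff₀ hm]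

theorem isRadon_of_moment_lt_top {ν : Measure E} (h : moment 2 ν < ∞) : IsRadon ν := by
  intro B hB
  rcases B.eq_empty_or_nonempty with rfl | hne
  · simp
  obtain ⟨x₀, -, hx₀⟩ := hB.exists_isMinOn hne
    (f := fun x : E => (x : ℝ)) continuous_subtype_val.continuousOn
  have hpos : (0 : ℝ) < x₀ := x₀.2
  have h1 : B ⊆ {x : E | ENNReal.ofReal ((x₀ : ℝ) ^ 2) ≤ ENNReal.ofReal ((x : ℝ) ^ 2)} := by
    intro x hx
    have : (x₀ : ℝ) ≤ x := hx₀ hx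
    exact ENNReal.ofReal_le_ofReal (pow_le_pow_left₀ hpos.le this 2)
  refine (measure_mono h1).trans_lt ?_
  refine (meas_ge_le_lintegral_div (by fun_prop) (by simpa using hpos.ne')
    ENNReal.ofReal_ne_top).trans_lt ?_
  exact ENNReal.div_lt_top h.ne (by simpa using hpos.ne')

theorem sigmaFinite_of_moment_lt_top {ν : Measure E} (h : moment 2 ν < ∞) : SigmaFinite ν := by
  have : IsLocallyFiniteMeasure ν := by
    refine ⟨fun x => ?_⟩
    have : LocallyCompactSpace E := isOpen_Ioi.locallyCompactSpace
    obtain ⟨K, hK, hx⟩ := exists_compact_mem_nhds x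
    exact ⟨K, hx, isRadon_of_moment_lt_top h K hK⟩
  infer_instance

/-- For `x (1 - e^{-σx})` the increment times `x y` separates into `e^{-σx} x² · (1 - e^{-σy}) y`
and its mirror image. Each integrates to `ψ ∂ₛψ` at `σ`, and the factor `1/2` absorbs the two
copies; this is the source of Burgers' nonlinearity. -/
theorem coag_sum {ν : Measure E} (h : PsiIntegrable ν) {ι : Type*} (S : Finset ι) (a σ : ι → ℝ)
    (hσ : ∀ i ∈ S, 0 < σ i) :
    coag (fun x y => x * y) (fun x => ∑ i ∈ S, a i * ((1 - Real.exp (-σ i * x)) * x)) ν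
      = ∑ i ∈ S, a i * (psi ν (σ i) * lap 2 ν (σ i)) := by
  have key : ∀ x y : ℝ, ((∑ i ∈ S, a i * ((1 - Real.exp (-σ i * (x + y))) * (x + y)))
      - (∑ i ∈ S, a i * ((1 - Real.exp (-σ i * x)) * x))
      - (∑ i ∈ S, a i * ((1 - Real.exp (-σ i * y)) * y))) * (x * y)
      = ∑ i ∈ S, a i * ((Real.exp (-σ i * x) * x ^ 2) * ((1 - Real.exp (-σ i * y)) * y)
        + ((1 - Real.exp (-σ i * x)) * x) * (Real.exp (-σ i * y) * y ^ 2)) := by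
    intro x y
    rw [← Finset.sum_sub_distrib, ← Finset.sum_sub_distrib, Finset.sum_mul]
    refine Finset.sum_congr rfl fun i _ => ?_
    rw [mul_add (-σ i), Real.exp_add]
    ring
  have inner : ∀ x : ℝ, ∫ y : E, ∑ i ∈ S, a i * ((Real.exp (-σ i * x) * x ^ 2) *
        ((1 - Real.exp (-σ i * y)) * y)
        + ((1 - Real.exp (-σ i * x)) * x) * (Real.exp (-σ i * y) * (y : ℝ) ^ 2)) ∂ν
      = ∑ i ∈ S, a i * ((Real.exp (-σ i * x) * x ^ 2) * psi ν (σ i)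
        + ((1 - Real.exp (-σ i * x)) * x) * lap 2 ν (σ i)) := by
    intro x
    have h1 : ∀ i ∈ S, Integrable (fun y : E => (Real.exp (-σ i * x) * x ^ 2) *
        ((1 - Real.exp (-σ i * y)) * (y : ℝ))) ν := fun i hi => (h _ (hσ i hi)).const_mul _
    have h2 : ∀ i ∈ S, Integrable (fun y : E => ((1 - Real.exp (-σ i * x)) * x) *
        (Real.exp (-σ i * y) * (y : ℝ) ^ 2)) ν :=
      fun i hi => (h.exp_mul_pow (hσ i hi) le_rfl).const_mul _
    have h3 : ∀ i ∈ S, Integrable (fun y : E => a i * ((Real.exp (-σ i * x) * x ^ 2) *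
        ((1 - Real.exp (-σ i * y)) * y) + ((1 - Real.exp (-σ i * x)) * x) *
          (Real.exp (-σ i * y) * (y : ℝ) ^ 2))) ν :=
      fun i hi => ((h1 i hi).add (h2 i hi)).const_mul (a i)
    rw [integral_finsetSum _ h3]
    refine Finset.sum_congr rfl fun i hi => ?_
    rw [integral_const_mul, integral_add (h1 i hi) (h2 i hi), integral_const_mul,
      integral_const_mul]
    rfl
  simp only [coag, key, inner]
  have h1 : ∀ i ∈ S, Integrable (fun x : E => (Real.exp (-σ i * x) * (x : ℝ) ^ 2) * psi ν (σ i)) ν :=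
    fun i hi => (h.exp_mul_pow (hσ i hi) le_rfl).mul_const _
  have h2 : ∀ i ∈ S, Integrable (fun x : E => ((1 - Real.exp (-σ i * x)) * (x : ℝ)) *
      lap 2 ν (σ i)) ν := fun i hi => (h _ (hσ i hi)).mul_const _
  have h3 : ∀ i ∈ S, Integrable (fun x : E => a i * ((Real.exp (-σ i * x) * (x : ℝ) ^ 2) *
      psi ν (σ i) + ((1 - Real.exp (-σ i * x)) * x) * lap 2 ν (σ i))) ν :=
    fun i hi => ((h1 i hi).add (h2 i hi)).const_mul (a i)
  rw [integral_finsetSum _ h3, Finset.mul_sum]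
  refine Finset.sum_congr rfl fun i hi => ?_
  rw [integral_const_mul, integral_add (h1 i hi) (h2 i hi), integral_mul_const,
    integral_mul_const]
  change 1 / 2 * (a i * (lap 2 ν (σ i) * psi ν (σ i) + psi ν (σ i) * lap 2 ν (σ i))) = _
  ring

namespace Tame

variable {ν : Measure E} {f g : ℝ → ℝ} {D : ℝ}

theorem integrable (hf : Tame D f) (h : moment 2 ν < ∞) : Integrable (fun x : E => f x) ν :=
  ((integrable_sq_of_moment_lt_top h).const_mul D).mono' hf.measurable.aestronglyMeasurable
    (Eventually.of_forall fun x => hf.abs_le x x.2)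

theorem abs_integral_le (hf : Tame D f) (h : moment 2 ν < ∞) :
    |∫ x : E, f x ∂ν| ≤ D * (moment 2 ν).toReal := by
  rw [← integral_sq_eq_toReal_moment, ← integral_const_mul]
  rw [← Real.norm_eq_abs]
  exact norm_integral_le_of_norm_le ((integrable_sq_of_moment_lt_top h).const_mul D)
    (Eventually.of_forall fun x => hf.abs_le x x.2)

theorem add {D' : ℝ} (hf : Tame D f) (hg : Tame D' g) : Tame (D + D') (fun x => f x + g x) := by
  refine ⟨hf.measurable.add hg.measurable, fun x hx => ?_, fun x hx y hy => ?_⟩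
  · refine (abs_add_le _ _).trans ?_
    linarith [hf.abs_le x hx, hg.abs_le x hx]
  · rw [show f (x + y) + g (x + y) - (f x + g x) - (f y + g y)
      = (f (x + y) - f x - f y) + (g (x + y) - g x - g y) by ring]
    refine (abs_add_le _ _).trans ?_
    linarith [hf.abs_increment_le x hx y hy, hg.abs_increment_le x hx y hy]

theorem integrable_increment (hf : Tame D f) (h : moment 2 ν < ∞) :
    Integrable (fun z : E × E => (f (z.1 + z.2) - f z.1 - f z.2) * ((z.1 : ℝ) * z.2))
      (ν.prod ν) := by
  have := sigmaFinite_of_moment_lt_top h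
  have hsq := integrable_sq_of_moment_lt_top h
  have hadd : Measurable fun z : E × E => f (z.1 + z.2) := by
    have h1 : Measurable fun z : E × E => (⟨(z.1 : ℝ) + z.2, add_pos (mem_Ioi.1 z.1.2) (mem_Ioi.1 z.2.2)⟩ : E) :=
      Measurable.subtype_mk (by fun_prop)
    exact hf.measurable.comp h1
  have h1 : Measurable fun z : E × E => f z.1 := hf.measurable.comp measurable_fst
  have h2 : Measurable fun z : E × E => f z.2 := hf.measurable.comp measurable_snd
  refine ((hsq.mul_prod hsq).const_mul (2 * D)).mono'
    (((hadd.sub h1).sub h2).mul (by fun_prop)).aestronglyMeasurable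
    (Eventually.of_forall fun z => ?_)
  have hx : (0 : ℝ) < z.1 := z.1.2
  have hy : (0 : ℝ) < z.2 := z.2.2
  have hxy := mul_pos hx hy
  rw [Real.norm_eq_abs, abs_mul, abs_of_pos hxy]
  have := mul_le_mul_of_nonneg_right (hf.abs_increment_le _ hx _ hy) hxy.le
  linarith

theorem coag_eq (hf : Tame D f) (h : moment 2 ν < ∞) :
    coag (fun x y => x * y) f ν
      = 1 / 2 * ∫ z : E × E, (f (z.1 + z.2) - f z.1 - f z.2) * ((z.1 : ℝ) * z.2) ∂(ν.prod ν) := by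
  have := sigmaFinite_of_moment_lt_top h
  rw [coag, integral_prod _ (hf.integrable_increment h)]

theorem abs_coag_le (hf : Tame D f) (h : moment 2 ν < ∞) :
    |coag (fun x y => x * y) f ν| ≤ D * (moment 2 ν).toReal ^ 2 := by
  have := sigmaFinite_of_moment_lt_top h
  have hsq := integrable_sq_of_moment_lt_top h
  rw [hf.coag_eq h, abs_mul, abs_of_pos one_half_pos]
  have h1 : |∫ z : E × E, (f (z.1 + z.2) - f z.1 - f z.2) * ((z.1 : ℝ) * z.2) ∂(ν.prod ν)|
      ≤ ∫ z : E × E, 2 * D * ((z.1 : ℝ) ^ 2 * (z.2 : ℝ) ^ 2) ∂(ν.prod ν) := by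
    rw [← Real.norm_eq_abs]
    refine norm_integral_le_of_norm_le ((hsq.mul_prod hsq).const_mul (2 * D))
      (Eventually.of_forall fun z => ?_)
    have hx : (0 : ℝ) < z.1 := z.1.2
    have hy : (0 : ℝ) < z.2 := z.2.2
    have hxy := mul_pos hx hy
    rw [Real.norm_eq_abs, abs_mul, abs_of_pos hxy]
    have := mul_le_mul_of_nonneg_right (hf.abs_increment_le _ hx _ hy) hxy.le
    linarith
  rw [integral_const_mul, integral_prod_mul (fun x : E => (x : ℝ) ^ 2) (fun x : E => (x : ℝ) ^ 2),
    integral_sq_eq_toReal_moment] at h1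
  linarith

theorem coag_add {D' : ℝ} (hf : Tame D f) (hg : Tame D' g) (h : moment 2 ν < ∞) :
    coag (fun x y => x * y) (fun x => f x + g x) ν
      = coag (fun x y => x * y) f ν + coag (fun x y => x * y) g ν := by
  rw [(hf.add hg).coag_eq h, hf.coag_eq h, hg.coag_eq h, ← mul_add,
    ← integral_add (hf.integrable_increment h) (hg.integrable_increment h)]
  congr 2
  ext z
  ring

end Tame

theorem integral_expSum {ν : Measure E} (h : PsiIntegrable ν) (n : ℕ) (a : ℕ → ℝ) :
    ∫ x : E, expSum n a x ∂ν = ∑ i ∈ Finset.range n, a i * psi ν (i + 1) := by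
  simp only [expSum]
  rw [integral_finsetSum _ fun i _ => (h _ (by positivity)).const_mul (a i)]
  exact Finset.sum_congr rfl fun i _ => integral_const_mul _ _

theorem coag_expSum {ν : Measure E} (h : PsiIntegrable ν) (n : ℕ) (a : ℕ → ℝ) :
    coag (fun x y => x * y) (expSum n a) ν
      = ∑ i ∈ Finset.range n, a i * (psi ν (i + 1) * lap 2 ν (i + 1)) :=
  coag_sum h (Finset.range n) a (fun i => (i : ℝ) + 1) fun i _ => by positivity

/-! ### Existence: the weak equation from Burgers' equation -/

theorem toReal_moment_le_of_forall {μ : Measure E} {ν : ℝ → Measure E}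
    (hmom : ∀ t, 0 ≤ t → t * (moment 2 μ).toReal < 1 →
      moment 2 (ν t) ≤ ENNReal.ofReal ((moment 2 μ).toReal / (1 - t * (moment 2 μ).toReal)))
    {t : ℝ} (htm : t * (moment 2 μ).toReal < 1) {r : ℝ}
    (hr : r ∈ Icc 0 t) :
    (moment 2 (ν r)).toReal ≤ (moment 2 μ).toReal / (1 - t * (moment 2 μ).toReal) := by
  have hm0 : 0 ≤ (moment 2 μ).toReal := ENNReal.toReal_nonneg
  have hrt := mul_le_mul_of_nonneg_right hr.2 hm0
  refine ENNReal.toReal_le_of_le_ofReal (div_nonneg hm0 (by linarith)) ?_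
  refine (hmom r hr.1 (hrt.trans_lt htm)).trans (ENNReal.ofReal_le_ofReal ?_)
  exact div_le_div_of_nonneg_left hm0 (by linarith) (by linarith)

section

variable {μ : Measure E} {ν : ℝ → Measure E} (h : moment 2 μ < ∞)
  (hmom : ∀ t, 0 ≤ t → t * (moment 2 μ).toReal < 1 →
    moment 2 (ν t) ≤ ENNReal.ofReal ((moment 2 μ).toReal / (1 - t * (moment 2 μ).toReal)))
  (hpsi : ∀ t, 0 ≤ t → t * (moment 2 μ).toReal < 1 → ∀ s > 0, psi (ν t) s = burgers μ t s)

include h hmom hpsi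

theorem lap_two_of_burgers {t : ℝ} (ht : 0 ≤ t) (htm : t * (moment 2 μ).toReal < 1)
    {s : ℝ} (hs : 0 < s) : lap 2 (ν t) s = lap 2 μ (s + t * burgers μ t s) /
      (1 - t * lap 2 μ (s + t * burgers μ t s)) := by
  refine ((psiIntegrable_of_moment_lt_top
    ((hmom t ht htm).trans_lt ENNReal.ofReal_lt_top)).hasDerivAt_psi hs).unique
    ((hasDerivAt_burgers h ht htm hs).congr_of_eventuallyEq ?_)
  filter_upwards [eventually_gt_nhds hs] with r hr using hpsi t ht htm r hr

theorem hasDerivWithinAt_psi_of_burgers {t : ℝ} (ht : 0 ≤ t)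
    (htm : t * (moment 2 μ).toReal < 1) {s : ℝ} (hs : 0 < s) :
    HasDerivWithinAt (fun r => psi (ν r) s) (psi (ν t) s * lap 2 (ν t) s)
      {r | 0 ≤ r ∧ r * (moment 2 μ).toReal < 1} t := by
  rw [lap_two_of_burgers h hmom hpsi ht htm hs, hpsi t ht htm s hs]
  exact (hasDerivWithinAt_burgers h ht htm hs).congr (fun r hr => hpsi r hr.1 hr.2 s hs)
    (hpsi t ht htm s hs)

theorem continuousOn_psi_time_of_burgers {s : ℝ} (hs : 0 < s) :
    ContinuousOn (fun r => psi (ν r) s) {r | 0 ≤ r ∧ r * (moment 2 μ).toReal < 1} :=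
  fun _ hr => (hasDerivWithinAt_psi_of_burgers h hmom hpsi hr.1 hr.2 hs).continuousWithinAt

theorem continuousOn_lap_time_of_burgers {s : ℝ} (hs : 0 < s) :
    ContinuousOn (fun r => lap 2 (ν r) s) {r | 0 ≤ r ∧ r * (moment 2 μ).toReal < 1} := by
  set I : Set ℝ := {r | 0 ≤ r ∧ r * (moment 2 μ).toReal < 1}
  have h1 : ContinuousOn (fun r => s + r * psi (ν r) s) I :=
    continuousOn_const.add (continuousOn_id.mul (continuousOn_psi_time_of_burgers h hmom hpsi hs))
  have hη : ∀ r ∈ I, 0 ≤ s + r * psi (ν r) s := fun r hr =>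
    add_nonneg hs.le (mul_nonneg hr.1 (psi_nonneg _ hs.le))
  have h2 : ContinuousOn (fun r => lap 2 μ (s + r * psi (ν r) s)) I :=
    (continuousOn_lap_two h).comp h1 hη
  have h3 : ContinuousOn (fun r => lap 2 μ (s + r * psi (ν r) s) /
      (1 - r * lap 2 μ (s + r * psi (ν r) s))) I :=
    h2.div (continuousOn_const.sub (continuousOn_id.mul h2))
      fun r hr => (one_sub_mul_lap_two_pos h hr.1 hr.2 (hη r hr)).ne'
  refine h3.congr fun r hr => ?_
  simp only
  rw [lap_two_of_burgers h hmom hpsi hr.1 hr.2 hs, hpsi r hr.1 hr.2 s hs]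

theorem psi_sub_psi_eq_integral_of_burgers {t : ℝ} (ht : 0 ≤ t)
    (htm : t * (moment 2 μ).toReal < 1) {s : ℝ} (hs : 0 < s) :
    IntervalIntegrable (fun τ => psi (ν τ) s * lap 2 (ν τ) s) volume 0 t ∧
    ∫ τ in (0 : ℝ)..t, psi (ν τ) s * lap 2 (ν τ) s = psi (ν t) s - psi (ν 0) s := by
  have hsub : Icc 0 t ⊆ {r | 0 ≤ r ∧ r * (moment 2 μ).toReal < 1} := fun r hr =>
    ⟨hr.1, (mul_le_mul_of_nonneg_right hr.2 ENNReal.toReal_nonneg).trans_lt htm⟩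
  have hc := ((continuousOn_psi_time_of_burgers h hmom hpsi hs).mul
    (continuousOn_lap_time_of_burgers h hmom hpsi hs)).mono hsub
  have hint : IntervalIntegrable (fun τ => psi (ν τ) s * lap 2 (ν τ) s) volume 0 t :=
    ContinuousOn.intervalIntegrable_of_Icc ht hc
  refine ⟨hint, intervalIntegral.integral_eq_sub_of_hasDerivAt_of_le ht
    ((continuousOn_psi_time_of_burgers h hmom hpsi hs).mono hsub) (fun r hr => ?_) hint⟩
  have hr' := hsub (Ioo_subset_Icc_self hr)
  exact (hasDerivWithinAt_psi_of_burgers h hmom hpsi hr'.1 hr'.2 hs).hasDerivAt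
    (mem_of_superset (Icc_mem_nhds hr.1 hr.2) hsub)

/-- For exponential sums this is Burgers' equation integrated in time. A tame error `ε` changes the
integrals by at most `ε M` and the coagulation term by at most `ε M²`, uniformly on `[0, t]`, so the
coagulation term of `f` is a uniform limit of continuous functions of time and the identity survives
the limit. -/
theorem weak_equation_of_burgers {f : ℝ → ℝ} (hf : IsTestFunction 2 f) {t : ℝ} (ht : 0 ≤ t)
    (htm : t * (moment 2 μ).toReal < 1) :
    Integrable (fun x : E => f x) (ν t) ∧
    IntervalIntegrable (fun τ => coag (fun x y => x * y) f (ν τ)) volume 0 t ∧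
    ∫ x : E, f x ∂(ν t) = ∫ x : E, f x ∂(ν 0)
      + ∫ τ in (0 : ℝ)..t, coag (fun x y => x * y) f (ν τ) := by
  set M := (moment 2 μ).toReal / (1 - t * (moment 2 μ).toReal) with hM
  have hm0 : 0 ≤ (moment 2 μ).toReal := ENNReal.toReal_nonneg
  have hM0 : 0 ≤ M := div_nonneg hm0 (by linarith)
  have hlt : ∀ r ∈ Icc 0 t, moment 2 (ν r) < ∞ := fun r hr => (hmom r hr.1
    ((mul_le_mul_of_nonneg_right hr.2 hm0).trans_lt htm)).trans_lt ENNReal.ofReal_lt_top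
  have hle : ∀ r ∈ Icc 0 t, (moment 2 (ν r)).toReal ≤ M := fun r hr =>
    toReal_moment_le_of_forall hmom htm hr
  have hψ : ∀ r ∈ Icc 0 t, PsiIntegrable (ν r) := fun r hr => psiIntegrable_of_moment_lt_top (hlt r hr)
  have h0t : (0 : ℝ) ∈ Icc 0 t := left_mem_Icc.2 ht
  have htt : t ∈ Icc 0 t := right_mem_Icc.2 ht
  have hsub : Icc 0 t ⊆ {r | 0 ≤ r ∧ r * (moment 2 μ).toReal < 1} := fun r hr =>
    ⟨hr.1, (mul_le_mul_of_nonneg_right hr.2 ENNReal.toReal_nonneg).trans_lt htm⟩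
  have happ : ∀ ε > 0, ∃ (n : ℕ) (a : ℕ → ℝ),
      (∀ r ∈ Icc 0 t, |∫ x : E, f x ∂(ν r) - ∫ x : E, expSum n a x ∂(ν r)| ≤ ε * M) ∧
      (∀ r ∈ Icc 0 t, |coag (fun x y => x * y) f (ν r) - coag (fun x y => x * y) (expSum n a) (ν r)|
        ≤ ε * M ^ 2) ∧ ∀ r ∈ Icc 0 t, Integrable (fun x : E => f x) (ν r) := by
    intro ε hε
    obtain ⟨n, a, hfa⟩ := hf.exists_tame_sub_expSum hε
    obtain ⟨D, hD⟩ := exists_tame_expSum n a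
    have hsum : (fun x => (f x - expSum n a x) + expSum n a x) = f := by ext x; ring
    refine ⟨n, a, fun r hr => ?_, fun r hr => ?_, fun r hr => ?_⟩
    · have h1 := (hfa.abs_integral_le (hlt r hr)).trans (mul_le_mul_of_nonneg_left (hle r hr) hε.le)
      have h2 : Integrable (fun x : E => f x) (ν r) := by
        have := (hfa.add hD).integrable (hlt r hr)
        simpa using this
      rwa [integral_sub h2 (hD.integrable (hlt r hr))] at h1
    · have h1 := (hfa.abs_coag_le (hlt r hr)).trans (mul_le_mul_of_nonneg_left
        (pow_le_pow_left₀ ENNReal.toReal_nonneg (hle r hr) 2) hε.le)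
      have h2 := hfa.coag_add hD (hlt r hr)
      rw [hsum] at h2
      rwa [h2, add_sub_cancel_right]
    · have := (hfa.add hD).integrable (hlt r hr)
      simpa using this
  have hcoagc : ∀ n a, ContinuousOn
      (fun r => coag (fun x y => x * y) (expSum n a) (ν r)) (Icc 0 t) := by
    intro n a
    have h1 : ContinuousOn (fun r => ∑ i ∈ Finset.range n,
        a i * (psi (ν r) (i + 1) * lap 2 (ν r) (i + 1))) (Icc 0 t) :=
      continuousOn_finsetSum _ fun i _ => continuousOn_const.mul
        (((continuousOn_psi_time_of_burgers h hmom hpsi (by positivity)).mul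
          (continuousOn_lap_time_of_burgers h hmom hpsi (by positivity))).mono hsub)
    exact h1.congr fun r hr => coag_expSum (hψ r hr) n a
  have hfc : ContinuousOn (fun r => coag (fun x y => x * y) f (ν r)) (Icc 0 t) := by
    refine continuousOn_of_uniform_approx_of_continuousOn fun u hu => ?_
    obtain ⟨ε, hε, hεu⟩ := Metric.mem_uniformity_dist.1 hu
    obtain ⟨n, a, -, h2, -⟩ := happ (ε / (2 * (M ^ 2 + 1))) (by positivity)
    refine ⟨_, hcoagc n a, fun r hr => hεu ?_⟩
    rw [Real.dist_eq]
    refine (h2 r hr).trans_lt ?_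
    rw [div_mul_eq_mul_div, div_lt_iff₀ (by positivity)]
    nlinarith [sq_nonneg M]
  have hfint : IntervalIntegrable (fun r => coag (fun x y => x * y) f (ν r)) volume 0 t :=
    ContinuousOn.intervalIntegrable_of_Icc ht hfc
  refine ⟨(happ 1 one_pos).choose_spec.choose_spec.2.2 t htt, hfint, ?_⟩
  rw [← sub_eq_zero, ← abs_nonpos_iff]
  refine le_of_forall_pos_le_add fun ε hε => ?_
  rw [zero_add]
  -- The error `2 M` comes from the integrals at the two end times and `M² t` from the time
  -- integral; the `1` keeps the denominator positive.
  obtain ⟨n, a, h1, h2, -⟩ := happ (ε / (2 * M + M ^ 2 * t + 1)) (by positivity)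
  set δ := ε / (2 * M + M ^ 2 * t + 1) with hδ
  have hgint : IntervalIntegrable (fun r => coag (fun x y => x * y) (expSum n a) (ν r))
      volume 0 t := ContinuousOn.intervalIntegrable_of_Icc ht (hcoagc n a)
  have hg : ∫ τ in (0 : ℝ)..t, coag (fun x y => x * y) (expSum n a) (ν τ)
      = ∫ x : E, expSum n a x ∂(ν t) - ∫ x : E, expSum n a x ∂(ν 0) := by
    rw [integral_expSum (hψ t htt), integral_expSum (hψ 0 h0t), ← Finset.sum_sub_distrib]
    have e : ∫ τ in (0 : ℝ)..t, coag (fun x y => x * y) (expSum n a) (ν τ)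
        = ∫ τ in (0 : ℝ)..t, ∑ i ∈ Finset.range n,
          a i * (psi (ν τ) (i + 1) * lap 2 (ν τ) (i + 1)) := by
      refine intervalIntegral.integral_congr fun r hr => ?_
      rw [uIcc_of_le ht] at hr
      exact coag_expSum (hψ r hr) n a
    have h3 := fun i : ℕ => psi_sub_psi_eq_integral_of_burgers h hmom hpsi ht htm
      (s := (i : ℝ) + 1) (by positivity)
    rw [e, intervalIntegral.integral_finsetSum fun i _ => (h3 i).1.const_mul (a i)]
    refine Finset.sum_congr rfl fun i _ => ?_
    rw [intervalIntegral.integral_const_mul, (h3 i).2]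
    ring
  have h3 : |∫ τ in (0 : ℝ)..t, (coag (fun x y => x * y) f (ν τ)
      - coag (fun x y => x * y) (expSum n a) (ν τ))| ≤ δ * M ^ 2 * |t - 0| := by
    rw [← Real.norm_eq_abs]
    refine intervalIntegral.norm_integral_le_of_norm_le_const fun r hr => ?_
    rw [uIoc_of_le ht] at hr
    exact h2 r (Ioc_subset_Icc_self hr)
  rw [intervalIntegral.integral_sub hfint hgint, hg, sub_zero, abs_of_nonneg ht] at h3
  have h4 := h1 t htt
  have h5 := h1 0 h0t
  have h6 : δ * (2 * M + M ^ 2 * t) ≤ ε := by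
    rw [hδ, div_mul_eq_mul_div, div_le_iff₀ (by positivity)]
    linarith
  rw [abs_le] at h3 h4 h5 ⊢
  constructor <;> linarith [h3.1, h3.2, h4.1, h4.2, h5.1, h5.2]

theorem isSolution_of_burgers (h0 : ν 0 = μ) :
    IsSolution (fun x y => x * y) 2 (moment 2 μ)⁻¹ ν := by
  have hmem := fun t => mem_timeInterval_inv_iff h (t := t)
  have hlt : ∀ t ∈ timeInterval (moment 2 μ)⁻¹, moment 2 (ν t) < ∞ := fun t ht =>
    (hmom t ((hmem t).1 ht).1 ((hmem t).1 ht).2).trans_lt ENNReal.ofReal_lt_top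
  refine ⟨fun t ht => isRadon_of_moment_lt_top (hlt t ht), by rwa [h0], fun B hB => ?_,
    fun t ht => ?_, fun f hf t ht => ?_, fun f hf t ht => ?_, fun f hf t ht => ?_⟩
  · have h1 : Measurable fun t : timeInterval (moment 2 μ)⁻¹ => ν t := by
      refine measurable_of_measurable_psi (fun t => psiIntegrable_of_moment_lt_top (hlt t t.2))
        fun s hs => ?_
      have h2 : ContinuousOn (fun r => psi (ν r) s) (timeInterval (moment 2 μ)⁻¹) :=
        (continuousOn_psi_time_of_burgers h hmom hpsi hs).mono fun r hr => (hmem r).1 hr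
      exact h2.domRestrict.measurable
    exact (Measure.measurable_coe hB.measurableSet).comp h1
  · obtain ⟨ht0, htm⟩ := (hmem t).1 ht
    have hm0 : 0 ≤ (moment 2 μ).toReal := ENNReal.toReal_nonneg
    have h1 : ∫⁻ τ in Ioc 0 t, moment 2 (ν τ) ^ 2 ≤ ∫⁻ _ in Ioc 0 t, ENNReal.ofReal
        ((moment 2 μ).toReal / (1 - t * (moment 2 μ).toReal)) ^ 2 := by
      refine setLIntegral_mono measurable_const fun r hr => pow_le_pow_left₀ zero_le ?_ 2
      have hr' : r ∈ Icc 0 t := Ioc_subset_Icc_self hr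
      have hfin := hlt r ((hmem r).2 ⟨hr'.1,
        (mul_le_mul_of_nonneg_right hr'.2 hm0).trans_lt htm⟩)
      rw [← ENNReal.ofReal_toReal hfin.ne]
      exact ENNReal.ofReal_le_ofReal (toReal_moment_le_of_forall hmom htm hr')
    refine h1.trans_lt ?_
    rw [setLIntegral_const, Real.volume_Ioc]
    exact ENNReal.mul_lt_top (ENNReal.pow_lt_top ENNReal.ofReal_lt_top) ENNReal.ofReal_lt_top
  · exact (weak_equation_of_burgers h hmom hpsi hf ((hmem t).1 ht).1 ((hmem t).1 ht).2).1
  · exact (weak_equation_of_burgers h hmom hpsi hf ((hmem t).1 ht).1 ((hmem t).1 ht).2).2.1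
  · exact (weak_equation_of_burgers h hmom hpsi hf ((hmem t).1 ht).1 ((hmem t).1 ht).2).2.2

end

/-! ### Uniqueness: every weak solution obeys the implicit equation -/

/-- Restricted to a compact set the measures are finite and closed sets form a generating π-system;
a compact exhaustion does the rest. This is what makes `τ ↦ m₂(ν_τ)` measurable. -/
theorem measurable_of_measurable_isCompact {T : Type*} [MeasurableSpace T] {ν : T → Measure E}
    (hR : ∀ t, IsRadon (ν t)) (h : ∀ B : Set E, IsCompact B → Measurable fun t => ν t B) :
    Measurable ν := by
  have : LocallyCompactSpace E := isOpen_Ioi.locallyCompactSpace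
  have hrestrict : ∀ n, Measurable fun t => (ν t).restrict (compactCovering E n) := by
    intro n
    have hK := isCompact_compactCovering E n
    have : ∀ t, IsFiniteMeasure ((ν t).restrict (compactCovering E n)) := fun t =>
      ⟨by rw [Measure.restrict_apply_univ]; exact hR t _ hK⟩
    have hF : ∀ F : Set E, IsClosed F →
        Measurable fun t => (ν t).restrict (compactCovering E n) F := by
      intro F hF
      simp_rw [Measure.restrict_apply hF.measurableSet]
      exact h _ (hK.inter_left hF)
    exact Measurable.measure_of_isPiSystem (S := {F | IsClosed F})
      ((BorelSpace.measurable_eq (α := E)).trans borel_eq_generateFrom_isClosed)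
      isPiSystem_isClosed (fun F => hF F) (hF _ isClosed_univ)
  refine Measure.measurable_of_measurable_coe _ fun B hB => ?_
  have e : ∀ t, ν t B = ⨆ n, (ν t).restrict (compactCovering E n) B := by
    intro t
    simp_rw [Measure.restrict_apply hB]
    rw [← Monotone.measure_iUnion, ← inter_iUnion, iUnion_compactCovering, inter_univ]
    exact fun i j hij => inter_subset_inter_right _ (compactCovering_subset E hij)
  simp_rw [e]
  exact Measurable.iSup fun n => (Measure.measurable_coe hB).comp (hrestrict n)

/-- Each term alone has derivative `1` at `0`; the difference cancels it. With `a ↓ 0` these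
functions approach `x (1 - e^{-b x})`, which grows linearly and is not a test function. -/
theorem isTestFunction_mul_exp_sub {a b : ℝ} (ha : 0 < a) (hb : 0 < b) :
    IsTestFunction 2 fun x => x * Real.exp (-a * x) - x * Real.exp (-b * x) := by
  have hexp : ∀ c x : ℝ, HasDerivAt (fun x => Real.exp (-c * x)) (-c * Real.exp (-c * x)) x := by
    intro c x
    have h1 : HasDerivAt (fun x : ℝ => -c * x) (-c * 1) x := (hasDerivAt_id x).const_mul (-c)
    exact h1.exp.congr_deriv (by ring)
  have hxexp : ∀ c x : ℝ, HasDerivAt (fun x => x * Real.exp (-c * x))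
      (Real.exp (-c * x) - c * (x * Real.exp (-c * x))) x := fun c x =>
    ((hasDerivAt_id x).mul (hexp c x)).congr_deriv (by simp only [id]; ring)
  have hd1 : iteratedDeriv 1 (fun x => x * Real.exp (-a * x) - x * Real.exp (-b * x))
      = fun x => (Real.exp (-a * x) - a * (x * Real.exp (-a * x)))
        - (Real.exp (-b * x) - b * (x * Real.exp (-b * x))) := by
    rw [iteratedDeriv_one]
    exact funext fun x => ((hxexp a x).sub (hxexp b x)).deriv
  have hd2 : iteratedDeriv 2 (fun x => x * Real.exp (-a * x) - x * Real.exp (-b * x))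
      = fun x => (-a * Real.exp (-a * x) - a * (Real.exp (-a * x) - a * (x * Real.exp (-a * x))))
        - (-b * Real.exp (-b * x) - b * (Real.exp (-b * x) - b * (x * Real.exp (-b * x)))) := by
    rw [iteratedDeriv_succ, hd1]
    exact funext fun x => (((hexp a x).sub ((hxexp a x).const_mul a)).sub
      ((hexp b x).sub ((hxexp b x).const_mul b))).deriv
  have hc0 : Continuous fun x : ℝ => x * Real.exp (-a * x) - x * Real.exp (-b * x) := by fun_prop
  have hlim1 : ∀ c > 0, Tendsto (fun x : ℝ => Real.exp (-c * x)) atTop (𝓝 0) := fun c hc =>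
    Real.tendsto_exp_atBot.comp (tendsto_id.const_mul_atTop_of_neg (neg_neg_of_pos hc))
  have hlim2 : ∀ c > 0, Tendsto (fun x : ℝ => x * Real.exp (-c * x)) atTop (𝓝 0) := fun c hc => by
    simpa using tendsto_rpow_mul_exp_neg_mul_atTop_nhds_zero 1 c hc
  have hle : ∀ c > 0, min a b ≤ c → ∀ x > 0,
      Real.exp (-c * x) ≤ Real.exp (-(min a b / 2) * x) ∧
      x * Real.exp (-c * x) ≤ 2 / c * Real.exp (-(min a b / 2) * x) := by
    intro c hc hmc x hx
    have h0 : 0 < min a b := lt_min ha hb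
    have h1 : Real.exp (-(c / 2) * x) ≤ Real.exp (-(min a b / 2) * x) :=
      Real.exp_le_exp.2 (by nlinarith)
    refine ⟨Real.exp_le_exp.2 (by nlinarith), ?_⟩
    have h2 := mul_exp_neg_le_one (c / 2 * x)
    have h3 : x * Real.exp (-c * x)
        = 2 / c * (c / 2 * x * Real.exp (-(c / 2 * x))) * Real.exp (-(c / 2) * x) := by
      have : Real.exp (-c * x) = Real.exp (-(c / 2 * x)) * Real.exp (-(c / 2) * x) := by
        rw [← Real.exp_add]; ring_nf
      rw [this]
      field_simp
    rw [h3]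
    refine mul_le_mul ?_ h1 (Real.exp_pos _).le (by positivity)
    exact mul_le_of_le_one_right (by positivity) h2
  refine ⟨ContDiff.contDiffOn (by fun_prop), fun j hj => ?_, fun j hj => ?_, ?_, fun j hj => ?_⟩
  · interval_cases j
    · rw [iteratedDeriv_zero]
      exact ⟨_, (hc0.tendsto 0).mono_left nhdsWithin_le_nhds⟩
    · rw [hd1]
      exact ⟨_, (Continuous.tendsto (by fun_prop) 0).mono_left nhdsWithin_le_nhds⟩
    · rw [hd2]
      exact ⟨_, (Continuous.tendsto (by fun_prop) 0).mono_left nhdsWithin_le_nhds⟩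
  · have ha1 := hlim1 a ha
    have ha2 := hlim2 a ha
    have hb1 := hlim1 b hb
    have hb2 := hlim2 b hb
    interval_cases j
    · rw [iteratedDeriv_zero]
      exact ⟨_, ha2.sub hb2⟩
    · rw [hd1]
      exact ⟨_, (ha1.sub (ha2.const_mul a)).sub (hb1.sub (hb2.const_mul b))⟩
    · rw [hd2]
      exact ⟨_, ((ha1.const_mul (-a)).sub ((ha1.sub (ha2.const_mul a)).const_mul a)).sub
        ((hb1.const_mul (-b)).sub ((hb1.sub (hb2.const_mul b)).const_mul b))⟩
  -- Half of the smaller rate is given up to absorb the factor `x`; `6` bounds the first derivative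
  -- and `4 a + 4 b` the second.
  · refine ⟨6 + 4 * a + 4 * b, min a b / 2, by positivity, fun x hx => ?_⟩
    have hs : Finset.Icc 1 2 = ({1, 2} : Finset ℕ) := by decide
    rw [hs, Finset.sum_pair (by norm_num), hd1, hd2]
    obtain ⟨ha1, ha2⟩ := hle a ha (min_le_left _ _) x hx
    obtain ⟨hb1, hb2⟩ := hle b hb (min_le_right _ _) x hx
    set e := Real.exp (-(min a b / 2) * x)
    have ha3 : a * (x * Real.exp (-a * x)) ≤ 2 * e := by
      have := mul_le_mul_of_nonneg_left ha2 ha.le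
      rwa [← mul_assoc a (2 / a), mul_div_cancel₀ _ ha.ne'] at this
    have hb3 : b * (x * Real.exp (-b * x)) ≤ 2 * e := by
      have := mul_le_mul_of_nonneg_left hb2 hb.le
      rwa [← mul_assoc b (2 / b), mul_div_cancel₀ _ hb.ne'] at this
    have ha0 : 0 ≤ Real.exp (-a * x) := (Real.exp_pos _).le
    have hb0 : 0 ≤ Real.exp (-b * x) := (Real.exp_pos _).le
    have ha4 : 0 ≤ a * (x * Real.exp (-a * x)) := by positivity
    have hb4 : 0 ≤ b * (x * Real.exp (-b * x)) := by positivity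
    have k1 : |(Real.exp (-a * x) - a * (x * Real.exp (-a * x)))
        - (Real.exp (-b * x) - b * (x * Real.exp (-b * x)))| ≤ 6 * e := by
      rw [abs_le]; constructor <;> linarith
    have ha5 := mul_le_mul_of_nonneg_left ha1 ha.le
    have hb5 := mul_le_mul_of_nonneg_left hb1 hb.le
    have ha6 := mul_le_mul_of_nonneg_left ha3 ha.le
    have hb6 := mul_le_mul_of_nonneg_left hb3 hb.le
    have ha7 := mul_nonneg ha.le ha0
    have hb7 := mul_nonneg hb.le hb0
    have ha8 := mul_nonneg ha.le ha4
    have hb8 := mul_nonneg hb.le hb4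
    have k2 : |(-a * Real.exp (-a * x) - a * (Real.exp (-a * x) - a * (x * Real.exp (-a * x))))
        - (-b * Real.exp (-b * x) - b * (Real.exp (-b * x) - b * (x * Real.exp (-b * x))))|
        ≤ (4 * a + 4 * b) * e := by
      rw [abs_le]; constructor <;> linarith
    linarith
  · interval_cases j
    · rw [iteratedDeriv_zero]
      simpa using (hc0.tendsto 0).mono_left (nhdsWithin_le_nhds (s := Ioi 0))
    · rw [hd1]
      have : Continuous fun x : ℝ => (Real.exp (-a * x) - a * (x * Real.exp (-a * x)))
        - (Real.exp (-b * x) - b * (x * Real.exp (-b * x))) := by fun_prop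
      simpa using (this.tendsto 0).mono_left (nhdsWithin_le_nhds (s := Ioi 0))

theorem coag_mul_exp_sub {ν : Measure E} (h : PsiIntegrable ν) {a b : ℝ} (ha : 0 < a)
    (hb : 0 < b) :
    coag (fun x y => x * y) (fun x => x * Real.exp (-a * x) - x * Real.exp (-b * x)) ν
      = psi ν b * lap 2 ν b - psi ν a * lap 2 ν a := by
  have h1 := coag_sum h (Finset.univ : Finset (Fin 2)) ![1, -1] ![b, a]
    (by intro i _; fin_cases i <;> simpa)
  simp only [Fin.sum_univ_two, Matrix.cons_val_zero, Matrix.cons_val_one] at h1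
  rw [show (fun x => x * Real.exp (-a * x) - x * Real.exp (-b * x))
    = fun x => 1 * ((1 - Real.exp (-b * x)) * x) + -1 * ((1 - Real.exp (-a * x)) * x) from
      funext fun x => by ring, h1]
  ring

theorem abs_psi_mul_lap_le {ν : Measure E} (h : moment 2 ν < ∞) {s : ℝ} (hs : 0 < s) :
    |psi ν s * lap 2 ν s| ≤ s * (moment 2 ν).toReal ^ 2 := by
  have h1 := psi_le_mul_moment h hs
  have h2 := lap_two_le_moment h hs.le
  have h3 := psi_nonneg ν hs.le
  have h4 := lap_nonneg 2 ν s
  rw [abs_of_nonneg (mul_nonneg h3 h4), sq, ← mul_assoc]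
  exact mul_le_mul h1 h2 h4 (h3.trans h1)

/-- By the mean value theorem the divided difference is a value of `lap 2 ν` between `a` and `b`,
and `lap 3 ν` is minus its derivative. The bound depends on `ν` only through `B`, hence is uniform
over times sharing `B`. -/
theorem abs_dslope_psi_sub_lap_le {ν : Measure E} (h : PsiIntegrable ν) {s a b B : ℝ}
    (hs : 0 < s) (ha : s ≤ a) (hb : s ≤ b) (hB : lap 3 ν s ≤ B) :
    |dslope (psi ν) a b - lap 2 ν a| ≤ B * |b - a| := by
  have hlip : ∀ x ∈ Ici s, ∀ y ∈ Ici s, |lap 2 ν y - lap 2 ν x| ≤ B * |y - x| := fun x hx y hy =>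
    (convex_Ici s).norm_image_sub_le_of_norm_hasDerivWithin_le
      (fun z hz => (h.hasDerivAt_lap (hs.trans_le hz) le_rfl).hasDerivWithinAt)
      (fun z hz => by
        rw [norm_neg, Real.norm_of_nonneg (lap_nonneg _ _ _)]
        exact (h.lap_anti hs hz (by norm_num)).trans hB) hx hy
  have hB0 : 0 ≤ B := (lap_nonneg _ _ _).trans hB
  have key : ∀ {x y : ℝ}, s ≤ x → x < y → ∃ ξ ∈ Ioo x y, lap 2 ν ξ = slope (psi ν) x y := by
    intro x y hx hxy
    have hd : ∀ z, x ≤ z → HasDerivAt (psi ν) (lap 2 ν z) z := fun z hz =>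
      h.hasDerivAt_psi (hs.trans_le (hx.trans hz))
    obtain ⟨ξ, hξ, e⟩ := exists_hasDerivAt_eq_slope (psi ν) (lap 2 ν) hxy
      (fun z hz => (hd z hz.1).continuousAt.continuousWithinAt) fun z hz => hd z hz.1.le
    exact ⟨ξ, hξ, by rw [e, slope_def_field]⟩
  rcases lt_trichotomy a b with hab | rfl | hab
  · rw [dslope_of_ne _ hab.ne']
    obtain ⟨ξ, hξ, e⟩ := key ha hab
    rw [← e]
    refine (hlip a ha ξ (ha.trans hξ.1.le)).trans (mul_le_mul_of_nonneg_left ?_ hB0)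
    rw [abs_of_pos (sub_pos.2 hξ.1), abs_of_pos (sub_pos.2 hab)]
    linarith [hξ.2]
  · rw [dslope_same, (h.hasDerivAt_psi (hs.trans_le ha)).deriv]
    simp
  · rw [dslope_of_ne _ hab.ne, slope_comm]
    obtain ⟨ξ, hξ, e⟩ := key hb hab
    rw [← e]
    refine (hlip a ha ξ (hb.trans hξ.1.le)).trans (mul_le_mul_of_nonneg_left ?_ hB0)
    rw [abs_of_neg (sub_neg.2 hξ.2), abs_of_neg (sub_neg.2 hab)]
    linarith [hξ.1]

theorem measurableSet_timeInterval (T : ℝ≥0∞) : MeasurableSet (timeInterval T) :=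
  measurableSet_Ici.inter (measurableSet_lt ENNReal.measurable_ofReal measurable_const)

theorem Icc_subset_timeInterval {T : ℝ≥0∞} {t : ℝ} (ht : t ∈ timeInterval T) :
    Icc 0 t ⊆ timeInterval T := fun _ hr =>
  ⟨hr.1, (ENNReal.ofReal_le_ofReal hr.2).trans_lt ht.2⟩

namespace IsSolution

variable {T : ℝ≥0∞} {ν : ℝ → Measure E} (hν : IsSolution (fun x y => x * y) 2 T ν) {t : ℝ}
  (ht : t ∈ timeInterval T)

include hν ht

theorem aemeasurable_moment :
    AEMeasurable (fun τ => moment 2 (ν τ)) (volume.restrict (Ioc 0 t)) := by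
  have h1 : Measurable fun τ : timeInterval T => ν τ :=
    measurable_of_measurable_isCompact (fun τ => hν.radon τ τ.2) hν.measurable
  have h2 : Measurable fun τ : timeInterval T => moment 2 (ν τ) :=
    (Measure.measurable_lintegral (by fun_prop)).comp h1
  exact (aemeasurable_restrict_of_measurable_subtype (measurableSet_timeInterval T) h2).mono_set
    (Ioc_subset_Icc_self.trans (Icc_subset_timeInterval ht))

theorem ae_moment_lt_top : ∀ᵐ τ ∂(volume.restrict (Ioc 0 t)), moment 2 (ν τ) < ∞ := by
  filter_upwards [ae_lt_top' ((hν.aemeasurable_moment ht).pow_const 2)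
    (hν.moment_sq t ht).ne] with τ hτ
  exact (ENNReal.pow_lt_top_iff.1 hτ).resolve_right two_ne_zero

theorem integrable_moment_sq :
    IntegrableOn (fun τ => (moment 2 (ν τ)).toReal ^ 2) (Ioc 0 t) := by
  have := integrable_toReal_of_lintegral_ne_top ((hν.aemeasurable_moment ht).pow_const 2)
    (hν.moment_sq t ht).ne
  simp only [ENNReal.toReal_pow] at this
  exact this

/-- The integrated form of Burgers' equation. -/
theorem psi_eq_add_integral {s : ℝ} (hs : 0 < s) :
    Integrable (fun x : E => (1 - Real.exp (-s * x)) * (x : ℝ)) (ν t) ∧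
    IntervalIntegrable (fun τ => psi (ν τ) s * lap 2 (ν τ) s) volume 0 t ∧
    psi (ν t) s = psi (ν 0) s + ∫ τ in (0 : ℝ)..t, psi (ν τ) s * lap 2 (ν τ) s := by
  have ht0 : 0 ≤ t := ht.1
  set ε : ℕ → ℝ := fun n => s / (n + 1) with hε
  have hε0 : ∀ n, 0 < ε n := fun n => by positivity
  have hεs : ∀ n, ε n ≤ s := fun n => div_le_self hs.le (by simp)
  have hεanti : Antitone ε := fun i j hij =>
    div_le_div_of_nonneg_left hs.le (by positivity) (by simpa using hij)
  have hεlim : Tendsto ε atTop (𝓝 0) := by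
    have := (tendsto_one_div_add_atTop_nhds_zero_nat (𝕜 := ℝ)).const_mul s
    rw [mul_zero] at this
    exact this.congr fun n => mul_one_div _ _
  -- Since `ε n` decreases to `0` and stays below `s`, these test functions are nonnegative and
  -- increase to `x (1 - e^{-s x})`.
  set G : ℕ → ℝ → ℝ := fun n x => x * Real.exp (-ε n * x) - x * Real.exp (-s * x) with hG
  have hGtest : ∀ n, IsTestFunction 2 (G n) := fun n => isTestFunction_mul_exp_sub (hε0 n) hs
  have hGmono : ∀ x : E, Monotone fun n => G n x := by
    intro x i j hij
    have hx : (0 : ℝ) < x := x.2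
    have : Real.exp (-ε i * x) ≤ Real.exp (-ε j * x) :=
      Real.exp_le_exp.2 (by nlinarith [hεanti hij])
    exact sub_le_sub_right (mul_le_mul_of_nonneg_left this hx.le) _
  have hG0 : ∀ n (x : E), 0 ≤ G n x := by
    intro n x
    have hx : (0 : ℝ) < x := x.2
    have : Real.exp (-s * x) ≤ Real.exp (-ε n * x) :=
      Real.exp_le_exp.2 (by nlinarith [hεs n])
    exact sub_nonneg.2 (mul_le_mul_of_nonneg_left this hx.le)
  have hGlim : ∀ x : E, Tendsto (fun n => G n x) atTop
      (𝓝 ((1 - Real.exp (-s * x)) * (x : ℝ))) := by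
    intro x
    have h1 : Tendsto (fun δ : ℝ => (x : ℝ) * Real.exp (-δ * x) - x * Real.exp (-s * x)) (𝓝 0)
        (𝓝 ((x : ℝ) * Real.exp (-0 * x) - x * Real.exp (-s * x))) :=
      Continuous.tendsto (by fun_prop) 0
    have h2 := h1.comp hεlim
    rw [show (x : ℝ) * Real.exp (-0 * x) - x * Real.exp (-s * x)
      = (1 - Real.exp (-s * x)) * (x : ℝ) by simp; ring] at h2
    exact h2
  have hGle : ∀ n (x : E), G n x ≤ (1 - Real.exp (-s * x)) * (x : ℝ) := fun n x =>
    (hGmono x).ge_of_tendsto (hGlim x) n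
  have hint0 : Tendsto (fun n => ∫ x : E, G n x ∂(ν 0)) atTop (𝓝 (psi (ν 0) s)) := by
    refine tendsto_integral_of_dominated_convergence
      (fun x : E => (1 - Real.exp (-s * x)) * (x : ℝ)) (fun n => by fun_prop)
      (psiIntegrable_of_moment_lt_top hν.moment_zero s hs)
      (fun n => Eventually.of_forall fun x => ?_) (Eventually.of_forall hGlim)
    rw [Real.norm_of_nonneg (hG0 n x)]
    exact hGle n x
  have hfin := hν.ae_moment_lt_top ht
  have hsq := hν.integrable_moment_sq ht
  have hcint := fun n => (intervalIntegrable_iff_integrableOn_Ioc_of_le ht0).1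
    (hν.intervalIntegrable (G n) (hGtest n) t ht)
  have hcoag : ∀ᵐ τ ∂(volume.restrict (Ioc 0 t)), ∀ n, coag (fun x y => x * y) (G n) (ν τ)
      = psi (ν τ) s * lap 2 (ν τ) s - psi (ν τ) (ε n) * lap 2 (ν τ) (ε n) := by
    filter_upwards [hfin] with τ hτ n
    exact coag_mul_exp_sub (psiIntegrable_of_moment_lt_top hτ) (hε0 n) hs
  have hclim : ∀ᵐ τ ∂(volume.restrict (Ioc 0 t)), Tendsto
      (fun n => coag (fun x y => x * y) (G n) (ν τ)) atTop
      (𝓝 (psi (ν τ) s * lap 2 (ν τ) s)) := by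
    filter_upwards [hfin, hcoag] with τ hτ hcτ
    simp_rw [hcτ]
    -- The unwanted term is at most `ε n · m₂(ν_τ)²`. As `m₂²` is integrable in time, domination
    -- carries its disappearance through the time integral.
    have h1 : Tendsto (fun n => psi (ν τ) (ε n) * lap 2 (ν τ) (ε n)) atTop (𝓝 0) := by
      refine squeeze_zero_norm (fun n => abs_psi_mul_lap_le hτ (hε0 n)) ?_
      simpa using hεlim.mul_const ((moment 2 (ν τ)).toReal ^ 2)
    simpa using h1.const_sub (psi (ν τ) s * lap 2 (ν τ) s)
  have hmeas : AEStronglyMeasurable (fun τ => psi (ν τ) s * lap 2 (ν τ) s)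
      (volume.restrict (Ioc 0 t)) :=
    aestronglyMeasurable_of_tendsto_ae atTop (fun n => (hcint n).1) hclim
  have hint : IntegrableOn (fun τ => psi (ν τ) s * lap 2 (ν τ) s) (Ioc 0 t) := by
    refine (hsq.const_mul s).mono' hmeas ?_
    filter_upwards [hfin] with τ hτ
    exact abs_psi_mul_lap_le hτ hs
  have hintlim : Tendsto (fun n => ∫ τ in (0 : ℝ)..t, coag (fun x y => x * y) (G n) (ν τ)) atTop
      (𝓝 (∫ τ in (0 : ℝ)..t, psi (ν τ) s * lap 2 (ν τ) s)) := by
    simp_rw [intervalIntegral.integral_of_le ht0]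
    refine tendsto_integral_of_dominated_convergence
      (fun τ => 2 * s * (moment 2 (ν τ)).toReal ^ 2) (fun n => (hcint n).1)
      (hsq.const_mul (2 * s)) (fun n => ?_) hclim
    filter_upwards [hfin, hcoag] with τ hτ hcτ
    rw [hcτ]
    refine (norm_sub_le _ _).trans ?_
    have h1 : ‖psi (ν τ) s * lap 2 (ν τ) s‖ ≤ _ := abs_psi_mul_lap_le hτ hs
    have h2 : ‖psi (ν τ) (ε n) * lap 2 (ν τ) (ε n)‖ ≤ _ := abs_psi_mul_lap_le hτ (hε0 n)
    have h3 := mul_le_mul_of_nonneg_right (hεs n) (sq_nonneg (moment 2 (ν τ)).toReal)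
    linarith
  set R := psi (ν 0) s + ∫ τ in (0 : ℝ)..t, psi (ν τ) s * lap 2 (ν τ) s with hR
  have hlimR : Tendsto (fun n => ∫ x : E, G n x ∂(ν t)) atTop (𝓝 R) := by
    have := hint0.add hintlim
    exact this.congr fun n => (hν.weak_eq (G n) (hGtest n) t ht).symm
  -- At time `t` integrability of the limit is not known beforehand. Monotone convergence yields it
  -- together with the value, from the convergence of the right-hand sides of the weak equation.
  have hlint : ∫⁻ x : E, ENNReal.ofReal ((1 - Real.exp (-s * x)) * (x : ℝ)) ∂(ν t)
      = ENNReal.ofReal R := by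
    have h1 : Tendsto (fun n => ∫⁻ x : E, ENNReal.ofReal (G n x) ∂(ν t)) atTop
        (𝓝 (∫⁻ x : E, ENNReal.ofReal ((1 - Real.exp (-s * x)) * (x : ℝ)) ∂(ν t))) := by
      refine lintegral_tendsto_of_tendsto_of_monotone (fun n => by fun_prop)
        (Eventually.of_forall fun x i j hij => ENNReal.ofReal_le_ofReal (hGmono x hij))
        (Eventually.of_forall fun x => ENNReal.tendsto_ofReal (hGlim x))
    refine tendsto_nhds_unique h1 ((ENNReal.tendsto_ofReal hlimR).congr fun n => ?_)
    exact ofReal_integral_eq_lintegral_ofReal (hν.integrable (G n) (hGtest n) t ht)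
      (Eventually.of_forall fun x => hG0 n x)
  have hF0 : ∀ x : E, 0 ≤ (1 - Real.exp (-s * x)) * (x : ℝ) := fun x =>
    one_sub_exp_mul_nonneg hs.le x.2.le
  refine ⟨⟨by fun_prop, ?_⟩, (intervalIntegrable_iff_integrableOn_Ioc_of_le ht0).2 hint, ?_⟩
  · rw [hasFiniteIntegral_iff_ofReal (Eventually.of_forall hF0), hlint]
    exact ENNReal.ofReal_lt_top
  · rw [psi, integral_eq_lintegral_of_nonneg_ae (Eventually.of_forall hF0) (by fun_prop), hlint,
      ENNReal.toReal_ofReal]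
    exact ge_of_tendsto' hlimR fun n => integral_nonneg (hG0 n)

theorem psiIntegrable : PsiIntegrable (ν t) := fun _ hs => (hν.psi_eq_add_integral ht hs).1

/-- The nonlinearity `ψ ∂ₛψ` is nonnegative, so `ψ` increases in time. The transform at the final
time then bounds everything needed on `[0, t]`, with no pointwise bound on `m₂`. -/
theorem psi_le {r s : ℝ} (hr : r ∈ Icc 0 t) (hs : 0 < s) : psi (ν r) s ≤ psi (ν t) s := by
  have h1 := hν.psi_eq_add_integral ht hs
  have h2 := hν.psi_eq_add_integral (Icc_subset_timeInterval ht hr) hs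
  rw [h1.2.2, h2.2.2]
  refine add_le_add_right (intervalIntegral.integral_mono_interval le_rfl hr.1 hr.2
    (Eventually.of_forall fun τ => mul_nonneg (psi_nonneg _ hs.le) (lap_nonneg _ _ _)) h1.2.1) _

theorem lap_two_le {r s : ℝ} (hr : r ∈ Icc 0 t) (hs : 0 < s) :
    lap 2 (ν r) s ≤ psi (ν t) s / s :=
  ((hν.psiIntegrable (Icc_subset_timeInterval ht hr)).lap_two_le hs).trans
    (div_le_div_of_nonneg_right (hν.psi_le ht hr hs) hs.le)

theorem lap_three_le {r s : ℝ} (hr : r ∈ Icc 0 t) (hs : 0 < s) :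
    lap 3 (ν r) s ≤ psi (ν t) (s / 2) / (s / 2) / (s / 2) := by
  have h1 := (hν.psiIntegrable (Icc_subset_timeInterval ht hr)).lap_succ_le (half_pos hs) le_rfl
  rw [show 2 * (s / 2) = s by ring] at h1
  exact h1.trans (div_le_div_of_nonneg_right (hν.lap_two_le ht hr (half_pos hs)) (half_pos hs).le)

theorem continuousOn_psi_time {s : ℝ} (hs : 0 < s) :
    ContinuousOn (fun r => psi (ν r) s) (Icc 0 t) := by
  have hint := (intervalIntegrable_iff_integrableOn_Icc_of_le ht.1).1
    (hν.psi_eq_add_integral ht hs).2.1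
  rw [← uIcc_of_le ht.1] at hint
  have h1 := intervalIntegral.continuousOn_primitive_interval hint
  rw [uIcc_of_le ht.1] at h1
  refine (h1.const_add (psi (ν 0) s)).congr fun r hr => ?_
  exact (hν.psi_eq_add_integral (Icc_subset_timeInterval ht hr) hs).2.2

/-- The `s`-derivative of `ψ` is a uniform limit of difference quotients, which are continuous in
time; uniformity comes from the bound on `lap 3`. -/
theorem continuousOn_lap_time {s : ℝ} (hs : 0 < s) :
    ContinuousOn (fun r => lap 2 (ν r) s) (Icc 0 t) := by
  refine continuousOn_of_uniform_approx_of_continuousOn fun u hu => ?_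
  obtain ⟨ε, hε, hεu⟩ := Metric.mem_uniformity_dist.1 hu
  set B := psi (ν t) (s / 2) / (s / 2) / (s / 2) with hB
  have hB0 : 0 ≤ B := by
    have := psi_nonneg (ν t) (half_pos hs).le
    positivity
  set δ := ε / (B + 1) with hδ
  have hδ0 : 0 < δ := by positivity
  refine ⟨fun r => dslope (psi (ν r)) s (s + δ), ?_, fun r hr => hεu ?_⟩
  · have h1 : ContinuousOn (fun r => (psi (ν r) (s + δ) - psi (ν r) s) / δ) (Icc 0 t) :=
      ((hν.continuousOn_psi_time ht (by positivity)).sub (hν.continuousOn_psi_time ht hs)).div_const δ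
    refine h1.congr fun r _ => ?_
    simp only
    rw [dslope_of_ne _ (by linarith : s < s + δ).ne', slope_def_field, add_sub_cancel_left]
  · rw [dist_comm, Real.dist_eq]
    refine (abs_dslope_psi_sub_lap_le (hν.psiIntegrable (Icc_subset_timeInterval ht hr)) hs le_rfl
      (by linarith) (hν.lap_three_le ht hr hs)).trans_lt ?_
    rw [add_sub_cancel_left, abs_of_pos hδ0, ← hB, hδ, mul_div_assoc', div_lt_iff₀ (by positivity)]
    nlinarith

theorem hasDerivWithinAt_psi_time {r s : ℝ} (hr : r ∈ Icc 0 t) (hs : 0 < s) :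
    HasDerivWithinAt (fun r => psi (ν r) s) (psi (ν r) s * lap 2 (ν r) s) (Icc 0 t) r := by
  have hc : ContinuousOn (fun r => psi (ν r) s * lap 2 (ν r) s) (Icc 0 t) :=
    (hν.continuousOn_psi_time ht hs).mul (hν.continuousOn_lap_time ht hs)
  have hr' := Icc_subset_timeInterval ht hr
  have : Fact (r ∈ Icc 0 t) := ⟨hr⟩
  have h1 : HasDerivWithinAt (fun u => ∫ τ in (0 : ℝ)..u, psi (ν τ) s * lap 2 (ν τ) s)
      (psi (ν r) s * lap 2 (ν r) s) (Icc 0 t) r :=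
    intervalIntegral.integral_hasDerivWithinAt_right (hν.psi_eq_add_integral hr' hs).2.1
      (hc.stronglyMeasurableAtFilter_nhdsWithin measurableSet_Icc r) (hc r hr)
  refine (h1.const_add (psi (ν 0) s)).congr (fun u hu => ?_)
    (hν.psi_eq_add_integral hr' hs).2.2
  exact (hν.psi_eq_add_integral (Icc_subset_timeInterval ht hu) hs).2.2

/-- The derivative of `ψ` along a straight line. -/
theorem hasDerivWithinAt_psi_line {r s c : ℝ} (hr : r ∈ Icc 0 t) (hs : 0 < s) (hc : 0 ≤ c) :
    HasDerivWithinAt (fun r => psi (ν r) (s + (t - r) * c))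
      ((psi (ν r) (s + (t - r) * c) - c) * lap 2 (ν r) (s + (t - r) * c)) (Icc 0 t) r := by
  set X : ℝ → ℝ := fun r => s + (t - r) * c with hX
  have hXs : ∀ u ∈ Icc 0 t, s ≤ X u := fun u hu => by
    have := mul_nonneg (sub_nonneg.2 hu.2) hc
    simp only [hX]; linarith
  have hXr : 0 < X r := hs.trans_le (hXs r hr)
  set B := psi (ν t) (s / 2) / (s / 2) / (s / 2)
  have hlim : Tendsto (fun u => dslope (psi (ν u)) (X r) (X u)) (𝓝[Icc 0 t] r)
      (𝓝 (lap 2 (ν r) (X r))) := by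
    have h1 := (hν.continuousOn_lap_time ht hXr) r hr
    have h2 : Tendsto (fun u => dslope (psi (ν u)) (X r) (X u) - lap 2 (ν u) (X r))
        (𝓝[Icc 0 t] r) (𝓝 0) := by
      have h3 : Tendsto (fun u => B * |X u - X r|) (𝓝[Icc 0 t] r) (𝓝 0) := by
        have : Continuous fun u => B * |X u - X r| := by fun_prop
        simpa using (this.tendsto r).mono_left (nhdsWithin_le_nhds (s := Icc 0 t))
      refine squeeze_zero_norm' ?_ h3
      filter_upwards [self_mem_nhdsWithin] with u hu
      exact abs_dslope_psi_sub_lap_le (hν.psiIntegrable (Icc_subset_timeInterval ht hu)) hs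
        (hXs r hr) (hXs u hu) (hν.lap_three_le ht hu hs)
    simpa using h2.add h1.tendsto
  -- The increment is split into a motion in `s` at the moving time `u`, treated here, and a change
  -- of time at the fixed point `X r`. The limit `hlim` lets the measure vary in the first part.
  have h1 : HasDerivWithinAt (fun u => psi (ν u) (X u) - psi (ν u) (X r))
      (-c * lap 2 (ν r) (X r)) (Icc 0 t) r := by
    rw [hasDerivWithinAt_iff_tendsto_slope]
    refine ((hlim.const_mul (-c)).mono_left (nhdsWithin_mono _ sdiff_subset)).congr' ?_
    filter_upwards [self_mem_nhdsWithin] with u hu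
    have hne : u - r ≠ 0 := sub_ne_zero.2 hu.2
    rw [slope_def_field, sub_self (psi (ν r) (X r)), sub_zero, eq_div_iff hne,
      ← sub_smul_dslope, smul_eq_mul]
    simp only [hX]
    ring
  have h2 := h1.add (hν.hasDerivWithinAt_psi_time ht hr hXr)
  refine (h2.congr_deriv (by ring)).congr (fun u _ => ?_) ?_
  · simp [hX]
  · simp [hX]

/-- The transform of a solution satisfies the implicit equation `c = ψ₀(s + t c)`. -/
theorem psi_eq_psi_zero {s : ℝ} (hs : 0 < s) :
    psi (ν t) s = psi (ν 0) (s + t * psi (ν t) s) := by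
  set c := psi (ν t) s with hc
  have hc0 : 0 ≤ c := psi_nonneg _ hs.le
  -- The deviation from constancy along the candidate characteristic. It vanishes at `r = t` and
  -- solves the linear equation `w' = w · lap 2`; its vanishing at `r = 0` is the claim. Time is
  -- reversed below so that the zero becomes an initial value.
  set w : ℝ → ℝ := fun r => psi (ν r) (s + (t - r) * c) - c with hw
  have hmaps : MapsTo (fun q => t - q) (Icc 0 t) (Icc 0 t) := fun q hq =>
    ⟨sub_nonneg.2 hq.2, sub_le_self _ hq.1⟩
  have hderiv : ∀ q ∈ Icc 0 t, HasDerivWithinAt (fun q => w (t - q))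
      (-(w (t - q) * lap 2 (ν (t - q)) (s + (t - (t - q)) * c))) (Icc 0 t) q := by
    intro q hq
    have h1 := (hν.hasDerivWithinAt_psi_line ht (hmaps hq) hs hc0).sub_const c
    have h2 : HasDerivWithinAt (fun q => t - q) (-1) (Icc 0 t) q :=
      ((hasDerivAt_id q).const_sub t).hasDerivWithinAt
    exact (HasDerivWithinAt.scomp q h1 h2 hmaps).congr_deriv (by simp [hw])
  -- Gronwall's constant: the line stays in `[s, ∞)`, where `lap 2` at every earlier time is at most
  -- `ψ(t,s)/s = c/s`.
  have hzero := eq_zero_of_abs_deriv_le_mul_abs_self_of_eq_zero_right (K := c / s)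
    (fun q hq => (hderiv q hq).continuousWithinAt)
    (fun q hq => (hderiv q (Ico_subset_Icc_self hq)).mono_of_mem_nhdsWithin
      (mem_of_superset (Icc_mem_nhdsGE hq.2) (Icc_subset_Icc_left hq.1)))
    (by simp [hw, hc]) (fun q hq => ?_) t (right_mem_Icc.2 ht.1)
  · simp only [hw, sub_self, sub_zero] at hzero
    linarith
  · have hq' := hmaps (Ico_subset_Icc_self hq)
    rw [norm_neg, norm_mul, mul_comm, Real.norm_of_nonneg (lap_nonneg _ _ _)]
    refine mul_le_mul_of_nonneg_right ?_ (norm_nonneg _)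
    refine ((hν.psiIntegrable (Icc_subset_timeInterval ht hq')).lap_anti hs ?_ le_rfl).trans
      (hν.lap_two_le ht hq' hs)
    have := mul_nonneg hq.1 hc0
    linarith

end IsSolution

end Smoluchowski

/-! ### Existence, Burgers' equation and uniqueness combined -/

theorem mainTheorem5 (ν₀ : Measure Smoluchowski.E) (hν₀ : Smoluchowski.IsRadon ν₀)
    (hm : Smoluchowski.moment 2 ν₀ < ∞) :
    ∃ ν : ℝ → Measure Smoluchowski.E,
      -- existence of a solution for `K(x,y) = xy` on `[0, 1/m₂(0))` with initial data `ν₀`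
      Smoluchowski.IsSolution (fun x y => x * y) 2 (Smoluchowski.moment 2 ν₀)⁻¹ ν ∧
      ν 0 = ν₀ ∧
      -- its transform `ψ(t,s)` solves the inviscid Burgers equation `∂ₜψ = ψ ∂ₛψ`
      (∀ t ∈ Smoluchowski.timeInterval (Smoluchowski.moment 2 ν₀)⁻¹, ∀ s : ℝ, 0 < s →
        Integrable (fun x : Smoluchowski.E => (1 - Real.exp (-s * x)) * (x : ℝ)) (ν t) ∧
        DifferentiableAt ℝ (Smoluchowski.psi (ν t)) s ∧
        HasDerivWithinAt (fun r => Smoluchowski.psi (ν r) s)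
          (Smoluchowski.psi (ν t) s * deriv (Smoluchowski.psi (ν t)) s)
          (Smoluchowski.timeInterval (Smoluchowski.moment 2 ν₀)⁻¹) t) ∧
      -- uniqueness
      (∀ ν' : ℝ → Measure Smoluchowski.E,
        Smoluchowski.IsSolution (fun x y => x * y) 2 (Smoluchowski.moment 2 ν₀)⁻¹ ν' →
        ν' 0 = ν₀ →
        ∀ t ∈ Smoluchowski.timeInterval (Smoluchowski.moment 2 ν₀)⁻¹, ν' t = ν t) := by
  have hiff := fun t => Smoluchowski.mem_timeInterval_inv_iff hm (t := t)
  have hex : ∀ t : ℝ, ∃ ν : Measure Smoluchowski.E, 0 ≤ t ∧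
      t * (Smoluchowski.moment 2 ν₀).toReal < 1 →
      Smoluchowski.moment 2 ν ≤ ENNReal.ofReal ((Smoluchowski.moment 2 ν₀).toReal /
        (1 - t * (Smoluchowski.moment 2 ν₀).toReal)) ∧
      ∀ s > 0, Smoluchowski.psi ν s = Smoluchowski.burgers ν₀ t s := by
    intro t
    by_cases ht : 0 ≤ t ∧ t * (Smoluchowski.moment 2 ν₀).toReal < 1
    · obtain ⟨ν, hν⟩ := Smoluchowski.exists_measure_psi_eq_burgers hm ht.1 ht.2
      exact ⟨ν, fun _ => hν⟩
    · exact ⟨0, fun h => absurd h ht⟩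
  choose ν hν using hex
  have hmom := fun t h1 h2 => (hν t ⟨h1, h2⟩).1
  have hpsi := fun t h1 h2 => (hν t ⟨h1, h2⟩).2
  have hint : ∀ t ∈ Smoluchowski.timeInterval (Smoluchowski.moment 2 ν₀)⁻¹,
      Smoluchowski.PsiIntegrable (ν t) := fun t ht =>
    Smoluchowski.psiIntegrable_of_moment_lt_top
      ((hν t ((hiff t).1 ht)).1.trans_lt ENNReal.ofReal_lt_top)
  -- The measure chosen at time `0` is known only through its transform, which is `ψ₀`; injectivity
  -- of the transform identifies it.
  have h0 : ν 0 = ν₀ := by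
    have h00 : (0 : ℝ) ∈ Smoluchowski.timeInterval (Smoluchowski.moment 2 ν₀)⁻¹ :=
      (hiff 0).2 (by simp)
    refine Smoluchowski.measure_ext_of_psi (hint 0 h00)
      (Smoluchowski.psiIntegrable_of_moment_lt_top hm) fun s hs => ?_
    rw [hpsi 0 le_rfl (by simp) s hs, Smoluchowski.burgers_eq hm le_rfl (by simp) hs.le,
      zero_mul, add_zero]
  have hI : {r : ℝ | 0 ≤ r ∧ r * (Smoluchowski.moment 2 ν₀).toReal < 1}
      = Smoluchowski.timeInterval (Smoluchowski.moment 2 ν₀)⁻¹ :=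
    Set.ext fun t => (hiff t).symm
  refine ⟨ν, Smoluchowski.isSolution_of_burgers hm hmom hpsi h0, h0, fun t ht s hs => ?_,
    fun ν' hν' h0' t ht => ?_⟩
  · have hd := (hint t ht).hasDerivAt_psi hs
    refine ⟨hint t ht s hs, hd.differentiableAt, ?_⟩
    rw [hd.deriv, ← hI]
    exact Smoluchowski.hasDerivWithinAt_psi_of_burgers hm hmom hpsi ((hiff t).1 ht).1
      ((hiff t).1 ht).2 hs
  · refine Smoluchowski.measure_ext_of_psi (hν'.psiIntegrable ht) (hint t ht) fun s hs => ?_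
    obtain ⟨ht0, htm⟩ := (hiff t).1 ht
    rw [hpsi t ht0 htm s hs]
    refine Smoluchowski.burgers_unique hm ht0 htm hs (Smoluchowski.psi_nonneg _ hs.le) ?_
    have h1 := hν'.psi_eq_psi_zero ht hs
    rwa [h0'] at h1
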